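/- Let $k$ be a field of characteristic $0$ with pairwise commuting derivations $\Delta=\{\delta_1,\dots,\delta_m\}$, let $\Theta$ be the monoid of derivative operators $\delta_1^{e_1}\cdots\delta_m^{e_m}$, let $Y=\{y_1,\dots,y_n\}$ be differential indeterminates, and let $k\{Y\}=k[\Theta Y]$ be the ring of differential polynomials. Fix a ranking on $\Theta Y$, i.e. a total order with $\theta u\ge u$ and $u\ge v\Rightarrow\theta u\ge\theta v$. For a non-constant $f$, the leader $\mathrm{ld}\,f$ is the highest variable in $f$; if $d$ is the degree of $f$ in it, the rank of $f$ is $(\mathrm{ld}\,f)^d$, the initial of $f$ is the coefficient of $(\mathrm{ld}\,f)^d$, and the separant is $\partial f/\partial\,\mathrm{ld}\,f$. For a set $A$ of non-constant polynomials, $\mathrm{ld}\,A$ is its set of leaders, $H_A$ the set of initials and separants of its elements, and $H_A^\infty$ the multiplicative monoid generated by $H_A$. $A$ is algebraically autoreduced if $\deg_{\mathrm{ld}\,g}f<\deg_{\mathrm{ld}\,g}g$ for all distinct $f,g\in A$; it is (differentially) autoreduced if, in addition, no proper derivative of $\mathrm{ld}\,g$ appears in $f$; it is triangular if its elements have distinct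 leaders; it is weak d-triangular if moreover no leader of an element is a derivative of the leader of another element. Sets of polynomials with distinct leaders are compared by rank as usual: $A$ is lower than $B$ if the lowest rank that occurs in exactly one of the two sets occurs in $A$ (for finite sets this is the usual comparison of the increasing lists of ranks). A characteristic set of a differential ideal $I$ is an autoreduced subset of $I$ of the lowest rank; if moreover $I=[A]:H_A^\infty$ for such a set $A$, then $A$ is a characterizing set of $I$ and $I$ is characterizable. An algebraic characteristic (characterizing) set of an ideal $J$ of a polynomial ring $k[Z]$, $Z\subseteq\Theta Y$, is defined in the same way with algebraically autoreduced subsets of $J$ and $J=(A):H_A^\infty$ in $k[Z]$. A characterizing set $A$ is canonical if every $f\in A$ is monic (its lexicographically highest monomial has coefficient $1$), the initial of $f$ does not involve $\mathrm{ld}\,A$, and $f$ has no non-constant factor free of $\mathrm{ld}\,A$. A differential prolongation of a set $F$ of differential polynomials (or of derivatives) is a set $G$ with $F\subseteq G\subseteq\Theta F$ such that $\Theta F\setminus G$ is closed under all $\delta\in\Delta$. If $L=\mathrm{ld}\,C$ and $L\subseteq\bar L\subseteq\Theta L$, put $Z_{\bar L}=\bar L\cup(\Theta Y\setminus\Theta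 L)$; the ideal $\bar I_{\bar L}=I\cap k[Z_{\bar L}]$ of $k[Z_{\bar L}]$ is called the prolongation ideal of $I$. An autoreduced set $C$ is coherent if for all $f,g\in C$ whose leaders have a least common derivative $v=\theta\,\mathrm{ld}\,f=\theta'\,\mathrm{ld}\,g$, the polynomial $s_g\,\theta f-s_f\,\theta' g$ ($s_f,s_g$ the separants) lies in $(\{p\in\Theta C:\mathrm{ld}\,p<v\}):H_C^\infty$. An algebraic pseudo-remainder of $f$ with respect to a triangular set $B$ is a polynomial $\mathrm{algrem}(f,B)$ that is algebraically reduced with respect to every element of $B$ and is obtained from $f$ by finitely many pseudo-divisions by elements $b\in B$ (each viewed in the variable $\mathrm{ld}\,b$, and performed only when the dividend is not algebraically reduced with respect to $b$). (1) Let $C$ be a coherent autoreduced set, $D$ a differential prolongation of $C$, and $I=[C]:H_C^\infty$ with $1\notin I$. Then $I$ is prime if and only if the prolongation ideal $\bar I_{\mathrm{ld}\,D}$ is prime, and $I$ is characterizable if and only if $\bar I_{\mathrm{ld}\,D}$ is characterizable. (2) Let $C$ be a characteristic set of $I=[C]:H_C^\infty$ with $1\notin I$, and let $\bar L$ be a differential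 prolongation of $L=\mathrm{ld}\,C$. There are triangular subsets $B\subseteq\Theta C$ with $\mathrm{ld}\,B=\mathrm{ld}\,\Theta C$. For every such $B$, every $f\in B$ has an algebraic pseudo-remainder with respect to $B\setminus\{f\}$, and, for any choice of these pseudo-remainders, the set $$A=\{\mathrm{algrem}(f,B\setminus\{f\})\;:\;f\in B,\ \mathrm{ld}\,f\in\bar L\}$$ is contained in $k[Z_{\bar L}]$ and is a characterizing set of $\bar I_{\bar L}$. (3) Conversely, with $C$, $I$, $\bar L$ as in (2), let $A$ be a characterizing set of $\bar I_{\bar L}$ and let $T$ be a weak d-triangular subset of $A$ of the least rank. If $T$ is differentially autoreduced, then $T$ is a characterizing set of $I$. If $A$ is the canonical characteristic set of $\bar I_{\bar L}$, then $T$ is the canonical characteristic set of $I$. -/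

import Mathlib

namespace DiffAlg

section Algebraic

/-! ### Triangular sets in a polynomial ring whose variables are totally ordered -/

variable {σ : Type*} [LinearOrder σ] {k : Type*} [Field k]

/-- `u` is the leader of `f`: the highest variable appearing in `f`. Elements of the coefficient
field have no leader. -/
def IsLeader (f : MvPolynomial σ k) (u : σ) : Prop :=
  u ∈ f.vars ∧ ∀ v ∈ f.vars, v ≤ u

/-- The set of leaders of the elements of `A`. -/
def leaders (A : Set (MvPolynomial σ k)) : Set σ :=
  {u | ∃ f ∈ A, IsLeader f u}

/-- The coefficient of `u ^ d` in `f`, where `f` is seen as a univariate polynomial in `u`. -/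
noncomputable def coeffAt (u : σ) (d : ℕ) (f : MvPolynomial σ k) : MvPolynomial σ k :=
  ∑ s ∈ f.support with s u = d, MvPolynomial.monomial (s.erase u) (f.coeff s)

open Classical in
/-- The initial of `f`: the leading coefficient of `f` as a polynomial in its leader
(the value at a constant is irrelevant). -/
noncomputable def initial (f : MvPolynomial σ k) : MvPolynomial σ k :=
  if h : f.vars.Nonempty then coeffAt (f.vars.max' h) (f.degreeOf (f.vars.max' h)) f else f

open Classical in
/-- The separant of `f`: the partial derivative of `f` with respect to its leader
(the value at a constant is irrelevant). -/
noncomputable def separant (f : MvPolynomial σ k) : MvPolynomial σ k :=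
  if h : f.vars.Nonempty then MvPolynomial.pderiv (f.vars.max' h) f else 0

/-- `H_A`: the set of all initials and separants of elements of `A`. -/
def HSet (A : Set (MvPolynomial σ k)) : Set (MvPolynomial σ k) :=
  initial '' A ∪ separant '' A

/-- The saturation `I : H^∞`, where `H^∞` is the multiplicative monoid generated by `H`. -/
noncomputable def saturation {R : Type*} [CommRing R] (I : Ideal R) (H : Set R) : Ideal R where
  carrier := {a | ∃ s ∈ Submonoid.closure H, s * a ∈ I}
  zero_mem' := ⟨1, Submonoid.one_mem _, by simp⟩
  add_mem' := by
    rintro a b ⟨s, hs, hsa⟩ ⟨t, ht, htb⟩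
    refine ⟨s * t, Submonoid.mul_mem _ hs ht, ?_⟩
    have h : s * t * (a + b) = t * (s * a) + s * (t * b) := by ring
    rw [h]
    exact I.add_mem (I.mul_mem_left _ hsa) (I.mul_mem_left _ htb)
  smul_mem' := by
    rintro c a ⟨s, hs, hsa⟩
    refine ⟨s, hs, ?_⟩
    have h : s * (c • a) = c * (s * a) := by rw [smul_eq_mul]; ring
    rw [h]
    exact I.mul_mem_left _ hsa

/-- The set of ranks of the elements of `A`; the rank `u ^ d` of a polynomial with leader `u` and
degree `d` in `u` is encoded by the pair `(u, d)`, and ranks are ordered lexicographically. -/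
def rankSet (A : Set (MvPolynomial σ k)) : Set (σ ×ₗ ℕ) :=
  {r | ∃ f ∈ A, ∃ u, IsLeader f u ∧ r = toLex (u, f.degreeOf u)}

/-- `A` has lower rank than `B`, for sets whose elements have pairwise distinct ranks.
If `A` and `B` are listed in the order of increasing rank, then at the first place where the lists
of ranks differ either the rank in `A` is lower, or `B` has come to its end and `A` has not.
In other words, the lowest rank that occurs in exactly one of the two sets occurs in `A`;
in this form the comparison makes sense for infinite sets too. -/
def LowerRank (A B : Set (MvPolynomial σ k)) : Prop :=
  ∃ r ∈ rankSet A, r ∉ rankSet B ∧ ∀ s < r, (s ∈ rankSet A ↔ s ∈ rankSet B)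

/-- `f` is algebraically reduced with respect to `g`. -/
def AlgReduced (f g : MvPolynomial σ k) : Prop :=
  ∀ u, IsLeader g u → f.degreeOf u < g.degreeOf u

/-- `A` is an algebraically autoreduced set of non-constant polynomials. -/
def AlgAutoreduced (A : Set (MvPolynomial σ k)) : Prop :=
  (∀ f ∈ A, f.vars.Nonempty) ∧ ∀ f ∈ A, ∀ g ∈ A, f ≠ g → AlgReduced f g

/-- `A` is triangular: it consists of non-constant polynomials with pairwise distinct leaders. -/
def Triangular (A : Set (MvPolynomial σ k)) : Prop :=
  (∀ f ∈ A, f.vars.Nonempty) ∧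
    ∀ f ∈ A, ∀ g ∈ A, ∀ u, IsLeader f u → IsLeader g u → f = g

/-- `A` is an algebraic characteristic set of `J`: an algebraically autoreduced subset of `J` of
the lowest rank. -/
def IsAlgCharSet (J : Ideal (MvPolynomial σ k)) (A : Set (MvPolynomial σ k)) : Prop :=
  AlgAutoreduced A ∧ A ⊆ J ∧
    ∀ B : Set (MvPolynomial σ k), AlgAutoreduced B → B ⊆ J → ¬ LowerRank B A

/-- `A` characterizes the algebraic ideal `J`: it is an algebraic characteristic set of `J` and
`J = (A) : H_A^∞`. -/
def IsAlgCharacterizing (J : Ideal (MvPolynomial σ k)) (A : Set (MvPolynomial σ k)) : Prop :=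
  IsAlgCharSet J A ∧ J = saturation (Ideal.span A) (HSet A)

/-- `J` is a characterizable algebraic ideal. -/
def IsAlgCharacterizable (J : Ideal (MvPolynomial σ k)) : Prop :=
  ∃ A, IsAlgCharacterizing J A

/-- One pseudo-division: `f` is not algebraically reduced with respect to `b`, and `g` is a
pseudo-remainder of `f` modulo `b`, both seen as univariate polynomials in the leader of `b`. -/
def PseudoDivStep (b f g : MvPolynomial σ k) : Prop :=
  ∃ u, IsLeader b u ∧ b.degreeOf u ≤ f.degreeOf u ∧ g.degreeOf u < b.degreeOf u ∧
    ∃ (a : ℕ) (q : MvPolynomial σ k), initial b ^ a * f = q * b + g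

/-- `g` is an algebraic pseudo-remainder of `f` with respect to `B`: it is obtained from `f` by
finitely many pseudo-divisions by elements of `B` (in any order), and it is algebraically reduced
with respect to all elements of `B`. -/
def IsAlgRem (B : Set (MvPolynomial σ k)) (f g : MvPolynomial σ k) : Prop :=
  Relation.ReflTransGen (fun p q => ∃ b ∈ B, PseudoDivStep b p q) f g ∧
    ∀ b ∈ B, AlgReduced g b

/-- `f` is monic: the coefficient of its highest monomial is `1`, where monomials are ordered
lexicographically, starting from the highest variable. -/
def IsLexMonic (f : MvPolynomial σ k) : Prop :=
  ∃ s ∈ f.support, f.coeff s = 1 ∧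
    ∀ t ∈ f.support, t ≠ s → ∃ u, t u < s u ∧ ∀ v, u < v → t v = s v

/-- The normal form conditions in the definition of a canonical characteristic set: each element
of `A` is monic, its initial does not depend on the leaders of `A`, and it has no non-constant
factor that is free of the leaders of `A`. -/
def IsCanonicalForm (A : Set (MvPolynomial σ k)) : Prop :=
  ∀ f ∈ A, (∀ u ∈ leaders A, u ∉ (initial f).vars) ∧
    (∀ g, g ∣ f → (∀ u ∈ leaders A, u ∉ g.vars) → g.vars = ∅) ∧
    IsLexMonic f

end Algebraic

section Differential

/-! ### Differential polynomials -/

/-- The set `ΘY` of derivatives `θ y`, for `θ = δ_1 ^ (op 1) ⋯ δ_m ^ (op m)` and `y` one of the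
differential indeterminates `y_1, …, y_n`. -/
@[ext]
structure DVar (m n : ℕ) where
  /-- the exponents of the derivative operator -/
  op : Fin m →₀ ℕ
  /-- the index of the differential indeterminate -/
  var : Fin n

/-- The action of a derivative operator on a derivative. -/
noncomputable def DVar.act {m n : ℕ} (θ : Fin m →₀ ℕ) (u : DVar m n) : DVar m n :=
  ⟨θ + u.op, u.var⟩

/-- The total order on derivatives is a ranking. -/
def IsRanking (m n : ℕ) [LinearOrder (DVar m n)] : Prop :=
  (∀ (θ : Fin m →₀ ℕ) (u : DVar m n), u ≤ u.act θ) ∧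
    ∀ (θ : Fin m →₀ ℕ) (u v : DVar m n), v ≤ u → v.act θ ≤ u.act θ

/-- `Θ L` for a set `L` of derivatives. -/
def thetaVars {m n : ℕ} (L : Set (DVar m n)) : Set (DVar m n) :=
  {v | ∃ u ∈ L, ∃ θ, v = u.act θ}

/-- `L'` is a differential prolongation of the set `L` of derivatives:
`L ⊆ L' ⊆ Θ L`, and `Θ L \ L'` is closed under differentiation. -/
def IsVarProlongation {m n : ℕ} (L L' : Set (DVar m n)) : Prop :=
  L ⊆ L' ∧ L' ⊆ thetaVars L ∧
    ∀ u ∈ thetaVars L \ L', ∀ i, u.act (Finsupp.single i 1) ∈ thetaVars L \ L'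

/-- The set of variables `Z = L' ∪ (ΘY \ Θ L)`. -/
def prolongationVars {m n : ℕ} (L L' : Set (DVar m n)) : Set (DVar m n) :=
  L' ∪ (thetaVars L)ᶜ

variable {k : Type*} [Field k] {m n : ℕ}

/-- The derivation of a polynomial ring that applies a derivation `d` to the coefficients. -/
noncomputable def coeffDeriv {σ : Type*} (d : Derivation ℤ k k) :
    Derivation ℤ (MvPolynomial σ k) (MvPolynomial σ k) :=
  have hc : ∀ (p : MvPolynomial σ k) (s : σ →₀ ℕ),
      (∑ t ∈ p.support, MvPolynomial.monomial t (d (p.coeff t))).coeff s = d (p.coeff s) := by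
    classical
    intro p s
    rw [MvPolynomial.coeff_sum]
    simp only [MvPolynomial.coeff_monomial]
    rw [Finset.sum_ite_eq']
    split_ifs with h
    · rfl
    · rw [MvPolynomial.notMem_support_iff.mp h, map_zero]
  Derivation.mk'
    (AddMonoidHom.toIntLinearMap
      { toFun := fun p => ∑ t ∈ p.support, MvPolynomial.monomial t (d (p.coeff t))
        map_zero' := by simp
        map_add' := fun p q => by
          ext s
          rw [hc, MvPolynomial.coeff_add, MvPolynomial.coeff_add, hc, hc, map_add] })
    (fun p q => by
      classical
      ext s
      change (∑ t ∈ (p * q).support, MvPolynomial.monomial t (d ((p * q).coeff t))).coeff s =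
        (p * (∑ t ∈ q.support, MvPolynomial.monomial t (d (q.coeff t))) +
          q * (∑ t ∈ p.support, MvPolynomial.monomial t (d (p.coeff t)))).coeff s
      rw [hc, mul_comm q, MvPolynomial.coeff_add, MvPolynomial.coeff_mul, MvPolynomial.coeff_mul,
        MvPolynomial.coeff_mul, map_sum, ← Finset.sum_add_distrib]
      refine Finset.sum_congr rfl fun x _ => ?_
      rw [hc, hc, Derivation.leibniz, smul_eq_mul, smul_eq_mul]
      ring)

/-- The derivation `δ_i` on the ring `k{Y}` of differential polynomials: it extends the given
derivation of `k` and maps `θ y` to `δ_i θ y`. -/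
noncomputable def dpDeriv (δ : Fin m → Derivation ℤ k k) (i : Fin m) :
    Derivation ℤ (MvPolynomial (DVar m n) k) (MvPolynomial (DVar m n) k) :=
  coeffDeriv (δ i) + (MvPolynomial.mkDerivation k fun u : DVar m n =>
    (MvPolynomial.X (u.act (Finsupp.single i 1)) : MvPolynomial (DVar m n) k)).restrictScalars ℤ

/-- The derivative operator `θ = δ_1 ^ (θ 1) ⋯ δ_m ^ (θ m)` applied to `f`. -/
noncomputable def thetaOp (δ : Fin m → Derivation ℤ k k) (θ : Fin m →₀ ℕ)
    (f : MvPolynomial (DVar m n) k) : MvPolynomial (DVar m n) k :=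
  (List.finRange m).foldr (fun i g => (dpDeriv δ i)^[θ i] g) f

/-- `Θ F` for a set `F` of differential polynomials. -/
def thetaSet (δ : Fin m → Derivation ℤ k k) (F : Set (MvPolynomial (DVar m n) k)) :
    Set (MvPolynomial (DVar m n) k) :=
  {g | ∃ f ∈ F, ∃ θ, g = thetaOp δ θ f}

/-- `[F]`: the differential ideal generated by `F`, that is, the ideal generated by `Θ F`. -/
noncomputable def diffSpan (δ : Fin m → Derivation ℤ k k) (F : Set (MvPolynomial (DVar m n) k)) :
    Ideal (MvPolynomial (DVar m n) k) :=
  Ideal.span (thetaSet δ F)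

/-- `G` is a differential prolongation of `F`. -/
def IsProlongation (δ : Fin m → Derivation ℤ k k) (F G : Set (MvPolynomial (DVar m n) k)) : Prop :=
  F ⊆ G ∧ G ⊆ thetaSet δ F ∧
    ∀ f ∈ thetaSet δ F \ G, ∀ i, dpDeriv δ i f ∈ thetaSet δ F \ G

variable [LinearOrder (DVar m n)]

/-- `[A] : H_A^∞`. -/
noncomputable def satDiffIdeal (δ : Fin m → Derivation ℤ k k)
    (A : Set (MvPolynomial (DVar m n) k)) : Ideal (MvPolynomial (DVar m n) k) :=
  saturation (diffSpan δ A) (HSet A)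

/-- `f` is partially reduced with respect to `g`: no proper derivative of the leader of `g`
appears in `f`. -/
def PartiallyReduced (f g : MvPolynomial (DVar m n) k) : Prop :=
  ∀ u, IsLeader g u → ∀ θ, θ ≠ 0 → u.act θ ∉ f.vars

/-- `A` is a (differentially) autoreduced set of non-constant differential polynomials. -/
def Autoreduced (A : Set (MvPolynomial (DVar m n) k)) : Prop :=
  (∀ f ∈ A, f.vars.Nonempty) ∧
    ∀ f ∈ A, ∀ g ∈ A, f ≠ g → PartiallyReduced f g ∧ AlgReduced f g

/-- `A` is a weak d-triangular set: it consists of non-constant differential polynomials and no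
leader of an element is a (proper or improper) derivative of the leader of another element. -/
def WeakDTriangular (A : Set (MvPolynomial (DVar m n) k)) : Prop :=
  (∀ f ∈ A, f.vars.Nonempty) ∧
    ∀ f ∈ A, ∀ g ∈ A, f ≠ g → ∀ u v, IsLeader f u → IsLeader g v → ∀ θ, u ≠ v.act θ

/-- `C` is coherent: for all `f, g` in `C` with leaders `φ y` and `ψ y` and least common derivative
`v = θ φ y = θ' ψ y`, the Δ-polynomial `s_g θ f - s_f θ' g` lies in `(Θ C_{< v}) : H_C^∞`, where
`Θ C_{< v}` consists of all derivatives of elements of `C` with leader lower than `v`. -/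
def Coherent (δ : Fin m → Derivation ℤ k k) (C : Set (MvPolynomial (DVar m n) k)) : Prop :=
  ∀ f ∈ C, ∀ g ∈ C, ∀ u v, IsLeader f u → IsLeader g v → u.var = v.var →
    separant g * thetaOp δ (u.op ⊔ v.op - u.op) f - separant f * thetaOp δ (u.op ⊔ v.op - v.op) g ∈
      saturation
        (Ideal.span {p ∈ thetaSet δ C | ∃ w, IsLeader p w ∧ w < ⟨u.op ⊔ v.op, u.var⟩})
        (HSet C)

/-- `A` is a characteristic set of `I` in Kolchin's sense: an autoreduced subset of the lowest
rank. -/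
def IsDiffCharSet (I : Ideal (MvPolynomial (DVar m n) k)) (A : Set (MvPolynomial (DVar m n) k)) :
    Prop :=
  Autoreduced A ∧ A ⊆ I ∧
    ∀ B : Set (MvPolynomial (DVar m n) k), Autoreduced B → B ⊆ I → ¬ LowerRank B A

/-- `A` characterizes the differential ideal `I`: it is a characteristic set of `I` and
`I = [A] : H_A^∞`. -/
def IsDiffCharacterizing (δ : Fin m → Derivation ℤ k k) (I : Ideal (MvPolynomial (DVar m n) k))
    (A : Set (MvPolynomial (DVar m n) k)) : Prop :=
  IsDiffCharSet I A ∧ I = satDiffIdeal δ A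

/-- `I` is a characterizable differential ideal. -/
def IsDiffCharacterizable (δ : Fin m → Derivation ℤ k k)
    (I : Ideal (MvPolynomial (DVar m n) k)) : Prop :=
  ∃ A, IsDiffCharacterizing δ I A

/-- The ideal `I ∩ k[Z]` of the polynomial ring `k[Z]`, for a set `Z` of derivatives. The variables
of `k[Z]` are ordered as in `ΘY`. -/
noncomputable def restrictIdeal (I : Ideal (MvPolynomial (DVar m n) k)) (Z : Set (DVar m n)) :
    Ideal (MvPolynomial Z k) :=
  I.comap (MvPolynomial.rename (Subtype.val : Z → DVar m n))

/-- `A`, seen as a subset of `k{Y}`, for a subset `A` of `k[Z]`. -/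
def liftSet {Z : Set (DVar m n)} (A : Set (MvPolynomial Z k)) : Set (MvPolynomial (DVar m n) k) :=
  MvPolynomial.rename (Subtype.val : Z → DVar m n) '' A

/-- `T` is a weak d-triangular subset of `A` of the least rank. -/
def IsMinWeakDTriangular (A T : Set (MvPolynomial (DVar m n) k)) : Prop :=
  T ⊆ A ∧ WeakDTriangular T ∧
    ∀ T' : Set (MvPolynomial (DVar m n) k), T' ⊆ A → WeakDTriangular T' → ¬ LowerRank T' T

/-- `B` is a triangular subset of `Θ C` with the same set of leaders as `Θ C`. -/
def IsTriangularSection (δ : Fin m → Derivation ℤ k k) (C B : Set (MvPolynomial (DVar m n) k)) :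
    Prop :=
  B ⊆ thetaSet δ C ∧ Triangular B ∧ leaders B = leaders (thetaSet δ C)

end Differential

end DiffAlg

/-! Write I for `[C] : H_C^∞` and L for the set of leaders of `C`. Pseudo-reduction by the
derivatives of `C` gives, for every p, a relation s p ≡ g mod I in which s is a product of initials
and separants of `C`, hence a nonzerodivisor modulo I, and g contains no proper derivative of L
(`exists_mul_sub_mem`). Such a g lies in k[Z] for every prolongation. Therefore I is controlled by
its trace on k[Z]: primality passes from the trace to I (`restrictIdeal_isPrime_of`), and so does
the property of being a nonzerodivisor (`isNZDMod_of_supported`).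

Characterizing sets are first freed from ranks. For a proper ideal, an autoreduced subset has lowest
rank exactly when no nonzero element of the ideal is reduced with respect to it; the ideal is then
the saturation exactly when initials and separants are nonzerodivisors (`isAlgCharacterizing_iff`,
`isDiffCharSet_iff`, `isDiffCharacterizing_of`). The main tool is `PseudoDivStep.isNZDMod`: dividing
by elements of I with nonzerodivisor initials preserves the degree in the highest variable, and a
nonzerodivisor leading coefficient stays one, unless the divisor has that same leader in no larger
degree.

This yields (2): remainders of a triangular section of ΘC keep their leaders and degrees
(`IsTriangularSection.algRem_spec`). It also yields (3): a characterizing set of the trace must have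
every element of the prolongation as a leader, since otherwise a nonzero remainder would be a
reduced element of the ideal. Its elements with leader in L characterize I, and minimality
identifies them with `T`.

In (1), `C` is only coherent. Coherence puts I inside the saturation of the algebraic ideal of a
triangular section (`Coherent.satDiffIdeal_le`). If f in I has a leader u outside ΘL, a derivation
that kills the section and is transversal to u shows that ∂f/∂u is in I; iterating, so is the
initial of f (`Coherent.initial_mem`). An element of a characteristic set has a nonzero reduced
initial, so its leader must lie in ΘL. -/

namespace DiffAlg
open MvPolynomial

/-! ### Polynomials seen as univariate in one chosen variable -/

section Univariate

variable {σ : Type*} [LinearOrder σ] {k : Type*} [Field k]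

/-- A polynomial seen as a univariate polynomial in the variable `u`. -/
noncomputable def toUni (u : σ) : MvPolynomial σ k →ₐ[k] Polynomial (MvPolynomial σ k) :=
  aeval fun v => if v = u then Polynomial.X else Polynomial.C (X v)

theorem toUni_X_self (u : σ) : toUni (k := k) u (X u) = Polynomial.X := by simp [toUni]

theorem toUni_of_notMem {u : σ} {p : MvPolynomial σ k} (h : u ∉ p.vars) :
    toUni u p = Polynomial.C p := by
  refine hom_congr_vars (f₁ := (toUni u).toRingHom) (f₂ := Polynomial.C) ?_ ?_ rfl
  · ext a : 1
    simp only [AlgHom.toRingHom_eq_coe, RingHom.coe_comp, RingHom.coe_coe, Function.comp_apply]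
    rw [← algebraMap_eq, AlgHom.commutes]; rfl
  · intro i hi _
    have : i ≠ u := fun e => h (e ▸ hi)
    simp [toUni, this]

theorem toUni_monomial (u : σ) (s : σ →₀ ℕ) (a : k) :
    toUni u (monomial s a) = Polynomial.monomial (s u) (monomial (s.erase u) a) := by
  have h : (monomial s a : MvPolynomial σ k) = monomial (s.erase u) a * X u ^ s u := by
    rw [X_pow_eq_monomial, monomial_mul, mul_one, Finsupp.erase_add_single]
  have h2 : u ∉ (monomial (s.erase u) a : MvPolynomial σ k).vars := by
    by_cases ha : a = 0
    · simp [ha]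
    · rw [vars_monomial ha]; simp
  rw [h, map_mul, map_pow, toUni_X_self, toUni_of_notMem h2, Polynomial.C_mul_X_pow_eq_monomial]

theorem coeff_toUni (u : σ) (f : MvPolynomial σ k) (d : ℕ) :
    (toUni u f).coeff d = coeffAt u d f := by
  conv_lhs => rw [f.as_sum]
  rw [map_sum, Polynomial.finsetSum_coeff, coeffAt, Finset.sum_filter]
  refine Finset.sum_congr rfl fun s _ => ?_
  rw [toUni_monomial, Polynomial.coeff_monomial]

theorem notMem_vars_coeffAt (u : σ) (d : ℕ) (f : MvPolynomial σ k) : u ∉ (coeffAt u d f).vars := by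
  have h : coeffAt u d f ∈ supported k ({u}ᶜ : Set σ) := by
    refine Subalgebra.sum_mem _ fun s _ => ?_
    rw [mem_supported]
    by_cases ha : f.coeff s = 0
    · simp [ha]
    · rw [vars_monomial ha]; simp
  rw [mem_supported] at h
  intro hu
  exact h hu rfl

theorem coeffAt_mem_supported {S : Set σ} {f : MvPolynomial σ k} (hf : f ∈ supported k S) (u : σ)
    (d : ℕ) : coeffAt u d f ∈ supported k (S \ {u}) := by
  refine Subalgebra.sum_mem _ fun s hs => ?_
  rw [mem_supported]
  rw [Finset.mem_filter, mem_support_iff] at hs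
  rw [vars_monomial hs.1]
  intro v hv
  simp only [Finsupp.support_erase, Finset.coe_erase, Set.mem_sdiff, Finset.mem_coe,
    Set.mem_singleton_iff] at hv ⊢
  exact ⟨mem_supported.1 hf ((mem_vars_iff_mem_support v).2 ⟨s, by simpa using hs.1, hv.1⟩), hv.2⟩

theorem eval_toUni (u : σ) (f : MvPolynomial σ k) : (toUni u f).eval (X u) = f := by
  have h : ((Polynomial.aeval (R := MvPolynomial σ k) (X u)).restrictScalars k).comp (toUni u) =
      AlgHom.id k (MvPolynomial σ k) := by
    ext v : 1
    by_cases hv : v = u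
    · subst hv; simp [toUni]
    · simp [toUni, hv]
  exact DFunLike.congr_fun h f

theorem eq_sum_coeffAt (u : σ) (f : MvPolynomial σ k) :
    f = ∑ i ∈ Finset.range ((toUni u f).natDegree + 1), coeffAt u i f * X u ^ i := by
  conv_lhs => rw [← eval_toUni u f, Polynomial.eval_eq_sum_range]
  simp only [coeff_toUni]

omit [LinearOrder σ] in
theorem degreeOf_eq_zero_of_notMem {u : σ} {f : MvPolynomial σ k} (h : u ∉ f.vars) :
    f.degreeOf u = 0 := by
  by_contra h2
  exact h (mem_vars_iff_degreeOf_ne_zero.2 h2)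

theorem natDegree_toUni (u : σ) (f : MvPolynomial σ k) :
    (toUni u f).natDegree = f.degreeOf u := by
  apply le_antisymm
  · refine Polynomial.natDegree_le_iff_coeff_eq_zero.2 fun j hj => ?_
    rw [coeff_toUni, coeffAt, Finset.sum_eq_zero]
    intro s hs
    rw [Finset.mem_filter] at hs
    have := monomial_le_degreeOf u hs.1
    omega
  · conv_lhs => rw [eq_sum_coeffAt u f]
    refine (degreeOf_sum_le _ _ _).trans (Finset.sup_le fun i hi => ?_)
    refine (degreeOf_mul_le _ _ _).trans ?_
    rw [degreeOf_eq_zero_of_notMem (notMem_vars_coeffAt u i f), zero_add]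
    refine (degreeOf_pow_le _ _ _).trans ?_
    rw [degreeOf_X, if_pos rfl]
    have := Finset.mem_range.1 hi
    omega

theorem toUni_injective (u : σ) : Function.Injective (toUni (k := k) u) := fun f g h => by
  rw [← eval_toUni u f, h, eval_toUni]

theorem coeffAt_eq_zero_of_lt {u : σ} {f : MvPolynomial σ k} {d : ℕ} (h : f.degreeOf u < d) :
    coeffAt u d f = 0 := by
  rw [← coeff_toUni]
  exact Polynomial.coeff_eq_zero_of_natDegree_lt (by rwa [natDegree_toUni])

theorem degreeOf_lt_of_coeffAt {u : σ} {f : MvPolynomial σ k} {d : ℕ} (hd : 0 < d)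
    (h : ∀ j, d ≤ j → coeffAt u j f = 0) : f.degreeOf u < d := by
  rw [← natDegree_toUni]
  have : (toUni u f).natDegree ≤ d - 1 := Polynomial.natDegree_le_iff_coeff_eq_zero.2 fun j hj => by
    rw [coeff_toUni]; exact h j (by omega)
  omega

theorem coeffAt_degreeOf_ne_zero {u : σ} {f : MvPolynomial σ k} (hf : f ≠ 0) :
    coeffAt u (f.degreeOf u) f ≠ 0 := by
  rw [← coeff_toUni, ← natDegree_toUni]
  have : toUni u f ≠ 0 := fun h => hf (toUni_injective u (by rw [h, map_zero]))
  simpa using this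

theorem coeffAt_mul_of_notMem {u : σ} {a : MvPolynomial σ k} (ha : u ∉ a.vars)
    (f : MvPolynomial σ k) (d : ℕ) : coeffAt u d (a * f) = a * coeffAt u d f := by
  rw [← coeff_toUni, map_mul, toUni_of_notMem ha, Polynomial.coeff_C_mul, coeff_toUni]

theorem coeffAt_add (u : σ) (f g : MvPolynomial σ k) (d : ℕ) :
    coeffAt u d (f + g) = coeffAt u d f + coeffAt u d g := by
  simp only [← coeff_toUni, map_add, Polynomial.coeff_add]

theorem toUni_pderiv (u : σ) (f : MvPolynomial σ k) :
    toUni u (pderiv u f) = Polynomial.derivative (toUni u f) := by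
  induction f using MvPolynomial.induction_on' with
  | monomial s a =>
    rw [pderiv_monomial, toUni_monomial, toUni_monomial, Polynomial.derivative_monomial]
    have : (s - Finsupp.single u 1).erase u = s.erase u := by
      ext v
      by_cases hv : v = u
      · simp [hv]
      · simp [Finsupp.erase_ne hv, Ne.symm hv]
    rw [this]
    congr 1
    · simp
    · rw [← map_natCast C, mul_comm _ (C _), C_mul_monomial, mul_comm]
  | add p q hp hq => simp [hp, hq]

omit [LinearOrder σ] in
theorem pderiv_mem_supported {S : Set σ} {f : MvPolynomial σ k} (hf : f ∈ supported k S) (u : σ) :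
    pderiv u f ∈ supported k S := by
  rw [f.as_sum, map_sum]
  refine Subalgebra.sum_mem _ fun s hs => ?_
  rw [pderiv_monomial, mem_supported]
  by_cases ha : f.coeff s * (s u : k) = 0
  · simp [ha]
  · rw [vars_monomial ha]
    intro v hv
    refine mem_supported.1 hf ((mem_vars_iff_mem_support v).2 ⟨s, hs, ?_⟩)
    have := Finsupp.mem_support_iff.1 hv
    rw [Finsupp.mem_support_iff]
    intro h0
    simp [h0] at this

theorem pderiv_of_degreeOf_eq_one {u : σ} {f : MvPolynomial σ k} (h : f.degreeOf u = 1) :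
    pderiv u f = coeffAt u 1 f := by
  rw [← natDegree_toUni] at h
  rw [← eval_toUni u (pderiv u f), toUni_pderiv, Polynomial.eq_X_add_C_of_natDegree_le_one h.le]
  simp [coeff_toUni]

/-- Differentiating as often as the degree kills all lower terms. In characteristic 0 the factorial
is invertible, so an ideal containing this derivative contains the leading coefficient. -/
theorem iterate_pderiv_eq (u : σ) (f : MvPolynomial σ k) :
    (pderiv u)^[f.degreeOf u] f = C ((f.degreeOf u).factorial : k) *
      coeffAt u (f.degreeOf u) f := by
  have h : ∀ j, toUni u ((pderiv u)^[j] f) = Polynomial.derivative^[j] (toUni u f) := by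
    intro j
    induction j with
    | zero => rfl
    | succ j ih => rw [Function.iterate_succ_apply', Function.iterate_succ_apply', toUni_pderiv, ih]
  rw [← eval_toUni u ((pderiv u)^[_] f), h, ← natDegree_toUni,
    Polynomial.eq_C_of_natDegree_le_zero
      ((Polynomial.natDegree_iterate_derivative _ _).trans (Nat.sub_self _).le)]
  rw [Polynomial.eval_C, Polynomial.coeff_iterate_derivative, zero_add, Nat.descFactorial_self,
    coeff_toUni, nsmul_eq_mul, map_natCast]

end Univariate

/-! ### Leaders, initials and separants -/

section Leader

variable {σ : Type*} [LinearOrder σ] {k : Type*} [Field k]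

theorem IsLeader.unique {f : MvPolynomial σ k} {u v : σ} (hu : IsLeader f u) (hv : IsLeader f v) :
    u = v := le_antisymm (hv.2 u hu.1) (hu.2 v hv.1)

theorem exists_isLeader {f : MvPolynomial σ k} (hf : f.vars.Nonempty) : ∃ u, IsLeader f u :=
  ⟨f.vars.max' hf, f.vars.max'_mem hf, fun v hv => f.vars.le_max' v hv⟩

theorem IsLeader.nonempty {f : MvPolynomial σ k} {u : σ} (hu : IsLeader f u) : f.vars.Nonempty :=
  ⟨u, hu.1⟩

theorem IsLeader.max'_eq {f : MvPolynomial σ k} {u : σ} (hu : IsLeader f u) :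
    f.vars.max' hu.nonempty = u :=
  IsLeader.unique (f := f) ⟨f.vars.max'_mem _, fun v hv => f.vars.le_max' v hv⟩ hu

theorem IsLeader.initial_eq {f : MvPolynomial σ k} {u : σ} (hu : IsLeader f u) :
    initial f = coeffAt u (f.degreeOf u) f := by
  rw [initial, dif_pos hu.nonempty, hu.max'_eq]

theorem IsLeader.separant_eq {f : MvPolynomial σ k} {u : σ} (hu : IsLeader f u) :
    separant f = pderiv u f := by
  rw [separant, dif_pos hu.nonempty, hu.max'_eq]

theorem IsLeader.degreeOf_pos {f : MvPolynomial σ k} {u : σ} (hu : IsLeader f u) :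
    0 < f.degreeOf u := Nat.pos_of_ne_zero (mem_vars_iff_degreeOf_ne_zero.1 hu.1)

theorem IsLeader.ne_zero {f : MvPolynomial σ k} {u : σ} (hu : IsLeader f u) : f ≠ 0 := by
  rintro rfl
  simpa using hu.1

theorem IsLeader.mem_supported {f : MvPolynomial σ k} {u : σ} (hu : IsLeader f u) :
    f ∈ supported k (Set.Iic u) := MvPolynomial.mem_supported.2 fun v hv => hu.2 v hv

theorem isLeader_of_mem_supported {f : MvPolynomial σ k} {u : σ} (h : f ∈ supported k (Set.Iic u))
    (hd : f.degreeOf u ≠ 0) : IsLeader f u :=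
  ⟨mem_vars_iff_degreeOf_ne_zero.2 hd, fun _ hv => MvPolynomial.mem_supported.1 h hv⟩

theorem IsLeader.initial_ne_zero {f : MvPolynomial σ k} {u : σ} (hu : IsLeader f u) :
    initial f ≠ 0 := by
  rw [hu.initial_eq]
  exact coeffAt_degreeOf_ne_zero hu.ne_zero

theorem IsLeader.initial_mem_supported {f : MvPolynomial σ k} {u : σ} (hu : IsLeader f u) :
    initial f ∈ supported k ((f.vars : Set σ) \ {u}) := by
  rw [hu.initial_eq]
  exact coeffAt_mem_supported (MvPolynomial.mem_supported.2 subset_rfl) u _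

theorem IsLeader.notMem_vars_of_lt {f : MvPolynomial σ k} {u v : σ} (hu : IsLeader f u)
    (h : u < v) : v ∉ f.vars := fun hv => (hu.2 v hv).not_gt h

theorem degreeOf_coeffAt_le (u v : σ) (d : ℕ) (f : MvPolynomial σ k) :
    (coeffAt u d f).degreeOf v ≤ f.degreeOf v := by
  rw [coeffAt]
  refine (degreeOf_sum_le _ _ _).trans (Finset.sup_le fun s hs => ?_)
  rw [Finset.mem_filter, mem_support_iff] at hs
  rw [degreeOf_monomial_eq _ _ hs.1]
  refine le_trans ?_ (monomial_le_degreeOf v (mem_support_iff.2 hs.1))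
  by_cases h : v = u
  · simp [h]
  · simp [Finsupp.erase_ne h]

theorem IsLeader.notMem_vars_initial {f : MvPolynomial σ k} {u : σ} (hu : IsLeader f u) :
    u ∉ (initial f).vars := by
  rw [hu.initial_eq]; exact notMem_vars_coeffAt _ _ _

end Leader
end DiffAlg

namespace DiffAlg
open MvPolynomial

/-! ### Nonzerodivisors modulo an ideal, and saturation -/

section NZD

variable {R : Type*} [CommRing R]

/-- `h` is not a zero divisor modulo `I`. -/
def IsNZDMod (I : Ideal R) (h : R) : Prop := ∀ p, h * p ∈ I → p ∈ I

theorem IsNZDMod.one (I : Ideal R) : IsNZDMod I 1 := fun p hp => by rwa [one_mul] at hp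

theorem IsNZDMod.mul {I : Ideal R} {a b : R} (ha : IsNZDMod I a) (hb : IsNZDMod I b) :
    IsNZDMod I (a * b) := fun p hp => hb p (ha _ (by rwa [← mul_assoc]))

theorem IsNZDMod.pow {I : Ideal R} {a : R} (ha : IsNZDMod I a) (n : ℕ) : IsNZDMod I (a ^ n) := by
  induction n with
  | zero => rw [pow_zero]; exact IsNZDMod.one I
  | succ n ih => rw [pow_succ]; exact ih.mul ha

theorem IsNZDMod.closure {I : Ideal R} {H : Set R} (hH : ∀ h ∈ H, IsNZDMod I h) {s : R}
    (hs : s ∈ Submonoid.closure H) : IsNZDMod I s := by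
  induction hs using Submonoid.closure_induction with
  | mem x hx => exact hH x hx
  | one => exact IsNZDMod.one I
  | mul x y _ _ hx hy => exact hx.mul hy

theorem IsNZDMod.of_sub_mem {I : Ideal R} {a b : R} (ha : IsNZDMod I a) (h : a - b ∈ I) :
    IsNZDMod I b := fun p hp => ha p <| by
  have : a * p = (a - b) * p + b * p := by ring
  rw [this]
  exact I.add_mem (I.mul_mem_right _ h) hp

theorem IsNZDMod.notMem {I : Ideal R} {a : R} (ha : IsNZDMod I a) (h1 : (1 : R) ∉ I) : a ∉ I :=
  fun h => h1 (ha 1 (by rwa [mul_one]))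

theorem isNZDMod_saturation (I : Ideal R) {H : Set R} {h : R} (hh : h ∈ Submonoid.closure H) :
    IsNZDMod (saturation I H) h := by
  rintro p ⟨s, hs, hp⟩
  exact ⟨s * h, Submonoid.mul_mem _ hs hh, by rwa [mul_assoc]⟩

theorem le_saturation (I : Ideal R) (H : Set R) : I ≤ saturation I H := fun a ha =>
  ⟨1, Submonoid.one_mem _, by rwa [one_mul]⟩

/-- With `le_saturation` and `isNZDMod_saturation`: the saturation is the least ideal above `I`
modulo which all elements of `H` are nonzerodivisors. -/
theorem saturation_le {I J : Ideal R} {H : Set R} (hI : I ≤ J) (hH : ∀ h ∈ H, IsNZDMod J h) :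
    saturation I H ≤ J := by
  rintro a ⟨s, hs, ha⟩
  exact IsNZDMod.closure hH hs a (hI ha)

end NZD

/-! ### Pseudo-division and nonzerodivisor leading coefficients -/

section PseudoDivision

variable {σ : Type*} [LinearOrder σ] {k : Type*} [Field k]

theorem exists_pseudoDiv {b : MvPolynomial σ k} {u : σ} (hb : IsLeader b u) (n : ℕ) :
    ∀ f : MvPolynomial σ k, f.degreeOf u ≤ n → ∃ (a : ℕ) (q g : MvPolynomial σ k),
      initial b ^ a * f = q * b + g ∧ g.degreeOf u < b.degreeOf u := by
  induction n with
  | zero =>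
    intro f hf
    have := hb.degreeOf_pos
    exact ⟨0, 0, f, by simp, by omega⟩
  | succ n ih =>
    intro f hf
    rcases lt_or_ge (f.degreeOf u) (b.degreeOf u) with h | h
    · exact ⟨0, 0, f, by simp, h⟩
    have hpos := hb.degreeOf_pos
    set d := f.degreeOf u with hd
    set e := b.degreeOf u with he
    -- One elimination: both products have the same coefficient at `u ^ d`, so it cancels.
    have hlt : (initial b * f - coeffAt u d f * X u ^ (d - e) * b).degreeOf u < d := by
      refine degreeOf_lt_of_coeffAt (by omega) fun j hj => ?_
      rw [← coeff_toUni, map_sub, map_mul, map_mul, map_mul, map_pow, toUni_X_self,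
        toUni_of_notMem hb.notMem_vars_initial, toUni_of_notMem (notMem_vars_coeffAt _ _ _),
        mul_assoc, Polynomial.coeff_sub, Polynomial.coeff_C_mul, Polynomial.coeff_C_mul,
        Polynomial.coeff_X_pow_mul', if_pos (by omega), coeff_toUni, coeff_toUni]
      rcases hj.eq_or_lt with rfl | hj
      · rw [Nat.sub_sub_self h, he, ← hb.initial_eq]; ring
      · rw [coeffAt_eq_zero_of_lt (f := f) (by omega), coeffAt_eq_zero_of_lt (f := b) (by omega)]
        ring
    obtain ⟨a, q, g, h1, h2⟩ := ih _ (Nat.lt_succ_iff.1 (hlt.trans_le hf))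
    refine ⟨a + 1, q + initial b ^ a * (coeffAt u d f * X u ^ (d - e)), g, ?_, h2⟩
    linear_combination h1

theorem exists_pseudoDivStep {b f : MvPolynomial σ k} {u : σ} (hb : IsLeader b u)
    (h : b.degreeOf u ≤ f.degreeOf u) : ∃ g, PseudoDivStep b f g := by
  obtain ⟨a, q, g, h1, h2⟩ := exists_pseudoDiv hb _ f le_rfl
  exact ⟨g, u, hb, h, h2, a, q, h1⟩

theorem eq_zero_of_eq_mul {b g q : MvPolynomial σ k} {u : σ}
    (h : g.degreeOf u < b.degreeOf u) (hg : g + q * b = 0) : g = 0 := by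
  by_cases hq : q = 0
  · simpa [hq] using hg
  have hb : b ≠ 0 := by rintro rfl; simp at h
  have : g = -(q * b) := eq_neg_of_add_eq_zero_left hg
  rw [this, degreeOf_neg, degreeOf_mul_eq hq hb] at h
  omega

/-- As `v` is absent from `b` and its initial, the division identity can be read off coefficient by
coefficient in `v`, with one exponent `a` for all. A vanishing coefficient stays zero because its
remainder is a multiple of `b` of too small a degree. -/
theorem PseudoDivStep.exists_coeffAt {b f g : MvPolynomial σ k} (h : PseudoDivStep b f g) {v : σ}
    (hv : v ∉ b.vars) : ∃ a : ℕ, ∀ j, ∃ q, initial b ^ a * coeffAt v j f = q * b + coeffAt v j g ∧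
      (coeffAt v j f = 0 → coeffAt v j g = 0) := by
  obtain ⟨u, hu, -, hlt, a, q, hq⟩ := h
  refine ⟨a, fun j => ⟨coeffAt v j q, ?_⟩⟩
  have hi : v ∉ (initial b ^ a).vars := fun h =>
    hv (MvPolynomial.mem_supported.1 hu.initial_mem_supported (vars_pow _ _ h)).1
  have key : initial b ^ a * coeffAt v j f = coeffAt v j q * b + coeffAt v j g := by
    rw [← coeffAt_mul_of_notMem hi, hq, coeffAt_add, mul_comm q, coeffAt_mul_of_notMem hv, mul_comm]
  refine ⟨key, fun h0 => ?_⟩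
  rw [h0, mul_zero, add_comm] at key
  exact eq_zero_of_eq_mul ((degreeOf_coeffAt_le _ _ _ _).trans_lt hlt) key.symm

theorem PseudoDivStep.degreeOf_le {b f g : MvPolynomial σ k} (h : PseudoDivStep b f g) {v : σ}
    (hv : v ∉ b.vars) : g.degreeOf v ≤ f.degreeOf v := by
  obtain ⟨a, ha⟩ := h.exists_coeffAt hv
  refine Nat.lt_succ_iff.1 (degreeOf_lt_of_coeffAt (Nat.succ_pos _) fun j hj => ?_)
  obtain ⟨q, -, hq⟩ := ha j
  exact hq (coeffAt_eq_zero_of_lt (by omega))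

theorem PseudoDivStep.mem_supported {b f g : MvPolynomial σ k} (h : PseudoDivStep b f g)
    {S : Set σ} (hb : b ∈ supported k S) (hf : f ∈ supported k S) : g ∈ supported k S := by
  rw [MvPolynomial.mem_supported] at *
  intro v hv
  by_contra hvS
  have h1 := h.degreeOf_le (v := v) fun h' => hvS (hb h')
  rw [degreeOf_eq_zero_of_notMem (f := f) fun h' => hvS (hf h')] at h1
  exact mem_vars_iff_degreeOf_ne_zero.1 hv (by omega)

theorem PseudoDivStep.isLeader_le {b f g : MvPolynomial σ k} (h : PseudoDivStep b f g) {u v : σ}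
    (hf : f ∈ supported k (Set.Iic v)) (hu : IsLeader b u) : u ≤ v := by
  obtain ⟨w, hw, hle, -⟩ := h
  obtain rfl := hw.unique hu
  have := hw.degreeOf_pos
  exact MvPolynomial.mem_supported.1 hf (mem_vars_iff_degreeOf_ne_zero.2 (by omega))

/-- The coefficient of `v ^ d`, for `d` the degree of `f` in its highest variable `v`, remains
a nonzerodivisor under pseudo-division. -/
theorem PseudoDivStep.isNZDMod {I : Ideal (MvPolynomial σ k)} (h1 : 1 ∉ I)
    {b f g : MvPolynomial σ k} (h : PseudoDivStep b f g) (hbI : b ∈ I)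
    (hb : IsNZDMod I (initial b)) {v : σ} {d : ℕ}
    (hbv : IsLeader b v → d < b.degreeOf v)
    (hf : f ∈ supported k (Set.Iic v)) (hd : f.degreeOf v = d) (hc : IsNZDMod I (coeffAt v d f)) :
    b ∈ supported k (Set.Iio v) ∧
    g ∈ supported k (Set.Iic v) ∧ g.degreeOf v = d ∧ IsNZDMod I (coeffAt v d g) := by
  obtain ⟨u, hu, hle, -⟩ := id h
  -- A divisor with leader `v` itself would need degree at most `d`, which `hbv` rules out.
  have huv : u < v := by
    refine lt_of_le_of_ne (h.isLeader_le hf hu) ?_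
    rintro rfl
    have := hbv hu
    omega
  have hbs : b ∈ supported k (Set.Iio v) :=
    supported_mono (fun w hw => lt_of_le_of_lt hw huv) hu.mem_supported
  have hbv : v ∉ b.vars := hu.notMem_vars_of_lt huv
  have hcg : IsNZDMod I (coeffAt v d g) := by
    obtain ⟨a, ha⟩ := h.exists_coeffAt hbv
    obtain ⟨q, hq, -⟩ := ha d
    -- Modulo `b`, an element of `I`, the new coefficient is a power of the initial times the old
    -- one.
    refine ((hb.pow a).mul hc).of_sub_mem ?_
    rw [hq, add_sub_cancel_right]
    exact I.mul_mem_left _ hbI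
  refine ⟨hbs, h.mem_supported (supported_mono Set.Iio_subset_Iic_self hbs) hf,
    le_antisymm ((h.degreeOf_le hbv).trans hd.le) ?_, hcg⟩
  -- If the degree dropped, this coefficient would be 0, and a nonzerodivisor inside `I` forces `1 ∈
  -- I`.
  by_contra hlt
  refine hcg.notMem h1 ?_
  rw [coeffAt_eq_zero_of_lt (by omega)]
  exact I.zero_mem

theorem algRem_isNZDMod {I : Ideal (MvPolynomial σ k)} (h1 : 1 ∉ I) {B : Set (MvPolynomial σ k)}
    (hBI : B ⊆ I) (hB : ∀ b ∈ B, IsNZDMod I (initial b)) {v : σ} {d : ℕ}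
    (hBv : ∀ b ∈ B, IsLeader b v → d < b.degreeOf v) {f g : MvPolynomial σ k}
    (h : Relation.ReflTransGen (fun p q => ∃ b ∈ B, PseudoDivStep b p q) f g)
    (hf : f ∈ supported k (Set.Iic v)) (hd : f.degreeOf v = d) (hc : IsNZDMod I (coeffAt v d f)) :
    g ∈ supported k (Set.Iic v) ∧ g.degreeOf v = d ∧ IsNZDMod I (coeffAt v d g) := by
  induction h with
  | refl => exact ⟨hf, hd, hc⟩
  | tail _ h ih =>
    obtain ⟨b, hb, h⟩ := h
    exact (h.isNZDMod h1 (hBI hb) (hB b hb) (hBv b hb) ih.1 ih.2.1 ih.2.2).2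

theorem algRem_mem_supported {B : Set (MvPolynomial σ k)} {S : Set σ} {f g : MvPolynomial σ k}
    (h : Relation.ReflTransGen (fun p q => ∃ b ∈ B, PseudoDivStep b p q) f g)
    (hB : ∀ b ∈ B, b ∈ supported k S) (hf : f ∈ supported k S) : g ∈ supported k S := by
  induction h with
  | refl => exact hf
  | tail _ h ih =>
    obtain ⟨b, hb, h⟩ := h
    exact h.mem_supported (hB b hb) ih

theorem algRem_exists_mul {B : Set (MvPolynomial σ k)} {f g : MvPolynomial σ k}
    (h : Relation.ReflTransGen (fun p q => ∃ b ∈ B, PseudoDivStep b p q) f g) :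
    ∃ s ∈ Submonoid.closure (HSet B), s * f - g ∈ Ideal.span B := by
  induction h with
  | refl => exact ⟨1, Submonoid.one_mem _, by simp⟩
  | tail _ h ih =>
    obtain ⟨b, hb, u, hu, -, -, a, q, hq⟩ := h
    obtain ⟨s, hs, hsf⟩ := ih
    have hi : initial b ∈ Submonoid.closure (HSet B) :=
      Submonoid.subset_closure (Or.inl ⟨b, hb, rfl⟩)
    refine ⟨initial b ^ a * s, Submonoid.mul_mem _ (Submonoid.pow_mem _ hi a) hs, ?_⟩
    rw [← Ideal.add_mem_iff_left _ (Ideal.mul_mem_left _ (-q) (Ideal.subset_span hb))]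
    convert Ideal.mul_mem_left _ (initial b ^ a) hsf using 1
    linear_combination hq

theorem algRem_mem {I : Ideal (MvPolynomial σ k)} {B : Set (MvPolynomial σ k)} (hBI : B ⊆ I)
    {f g : MvPolynomial σ k}
    (h : Relation.ReflTransGen (fun p q => ∃ b ∈ B, PseudoDivStep b p q) f g) (hf : f ∈ I) :
    g ∈ I := by
  obtain ⟨s, -, hs⟩ := algRem_exists_mul h
  exact (I.sub_mem_iff_right (I.mul_mem_left s hf)).1 (Ideal.span_le.2 hBI hs)

theorem IsAlgRem.eq_self {B : Set (MvPolynomial σ k)} {f g : MvPolynomial σ k}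
    (h : IsAlgRem B f g) (hf : ∀ b ∈ B, AlgReduced f b) : g = f := by
  rcases Relation.ReflTransGen.cases_head h.1 with h | ⟨_, ⟨b, hb, u, hu, hle, -⟩, -⟩
  · exact h.symm
  · exact absurd (hf b hb u hu) hle.not_gt

/-- Always divide at the highest leader at which `f` fails to be reduced. Degrees in higher
variables do not grow, so new failures occur only at lower leaders, and the process ends because the
variables are well-ordered, even for infinite `B`. -/
theorem exists_isAlgRem [WellFoundedLT σ] {B : Set (MvPolynomial σ k)}
    (hB : ∀ f ∈ B, ∀ g ∈ B, ∀ u, IsLeader f u → IsLeader g u → f = g) (f : MvPolynomial σ k) :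
    ∃ g, IsAlgRem B f g := by
  let bad : MvPolynomial σ k → Set σ := fun f =>
    {u | ∃ b ∈ B, IsLeader b u ∧ b.degreeOf u ≤ f.degreeOf u}
  have hfin : ∀ f, (bad f).Finite := fun f => f.vars.finite_toSet.subset <| by
    rintro u ⟨b, -, hu, hle⟩
    have := hu.degreeOf_pos
    exact mem_vars_iff_degreeOf_ne_zero.2 (by omega)
  have hempty : ∀ f, ¬ (bad f).Nonempty → ∃ g, IsAlgRem B f g := fun f hf =>
    ⟨f, Relation.ReflTransGen.refl, fun b hb u hu => by
      by_contra hlt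
      exact hf ⟨u, b, hb, hu, not_lt.1 hlt⟩⟩
  have main : ∀ w, ∀ f, IsGreatest (bad f) w → ∃ g, IsAlgRem B f g := by
    intro w
    induction w using WellFoundedLT.induction with
    | ind w ih =>
      intro f hf
      obtain ⟨b, hb, hbw, hle⟩ := hf.1
      obtain ⟨f', hf'⟩ := exists_pseudoDivStep hbw hle
      have hlt : ∀ u ∈ bad f', u < w := by
        rintro u ⟨c, hc, hcu, hcle⟩
        by_contra hwu
        rcases (not_lt.1 hwu).eq_or_lt with rfl | hwu
        · obtain rfl := hB b hb c hc _ hbw hcu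
          obtain ⟨u', hu', -, h, -⟩ := hf'
          obtain rfl := hu'.unique hbw
          omega
        · exact (hf.2 ⟨c, hc, hcu, hcle.trans
            (hf'.degreeOf_le (hbw.notMem_vars_of_lt hwu))⟩).not_gt hwu
      have : ∃ g, IsAlgRem B f' g := by
        by_cases hne : (bad f').Nonempty
        · obtain ⟨m, hm⟩ := (hfin f').exists_maximalFor id _ hne
          exact ih m (hlt m hm.1) f' ⟨hm.1, fun x hx => by
            by_contra hlt
            exact hlt (hm.2 hx (not_le.1 hlt).le)⟩
        · exact hempty f' hne
      obtain ⟨g, hg⟩ := this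
      exact ⟨g, Relation.ReflTransGen.head ⟨b, hb, hf'⟩ hg.1, hg.2⟩
  by_cases hne : (bad f).Nonempty
  · obtain ⟨m, hm⟩ := (hfin f).exists_maximalFor id _ hne
    exact main m f ⟨hm.1, fun x hx => by
      by_contra hlt
      exact hlt (hm.2 hx (not_le.1 hlt).le)⟩
  · exact hempty f hne

end PseudoDivision

/-! ### Algebraic characteristic sets without reference to ranks -/

section CharacteristicSets

variable {σ : Type*} [LinearOrder σ] {k : Type*} [Field k]

theorem one_mem_of_vars_empty {J : Ideal (MvPolynomial σ k)} {p : MvPolynomial σ k} (hp : p ∈ J)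
    (hp0 : p ≠ 0) (hv : ¬ p.vars.Nonempty) : 1 ∈ J := by
  rw [Finset.not_nonempty_iff_eq_empty, vars_eq_empty_iff_eq_C] at hv
  have hc : p.coeff 0 ≠ 0 := fun h => hp0 (by rw [hv, h, C_0])
  have : C (p.coeff 0)⁻¹ * p = 1 := by
    conv_lhs => rw [hv]
    rw [← C_mul, coeff_C, if_pos rfl, inv_mul_cancel₀ hc, C_1]
  rw [← this]
  exact J.mul_mem_left _ hp

theorem AlgAutoreduced.triangular {A : Set (MvPolynomial σ k)} (hA : AlgAutoreduced A) :
    Triangular A := by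
  refine ⟨hA.1, fun f hf g hg u hfu hgu => ?_⟩
  by_contra hne
  exact lt_asymm (hA.2 f hf g hg hne u hgu) (hA.2 g hg f hf (Ne.symm hne) u hfu)

/-- The first difference is the rank of `p`: being reduced, `p` leaves no room in `A` for an element
with leader `u` and degree at most that of `p`. -/
theorem lowerRank_of_reduced {A : Set (MvPolynomial σ k)} {p : MvPolynomial σ k} {u : σ}
    (hu : IsLeader p u) (hp : ∀ a ∈ A, AlgReduced p a) :
    LowerRank ({a ∈ A | ∃ w, IsLeader a w ∧ w < u} ∪ {p}) A := by
  refine ⟨toLex (u, p.degreeOf u), ⟨p, Or.inr rfl, u, hu, rfl⟩, ?_, ?_⟩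
  · rintro ⟨a, ha, v, hv, h⟩
    obtain ⟨rfl, h⟩ := Prod.mk.inj (toLex.injective h)
    exact (hp a ha _ hv).ne h
  · intro s hs
    constructor
    · rintro ⟨a, ha | rfl, v, hv, rfl⟩
      · exact ⟨a, ha.1, v, hv, rfl⟩
      · obtain rfl := hv.unique hu
        exact absurd hs (lt_irrefl _)
    · rintro ⟨a, ha, v, hv, rfl⟩
      rw [Prod.Lex.toLex_lt_toLex] at hs
      rcases hs with hs | ⟨rfl, hs⟩
      · exact ⟨a, Or.inl ⟨ha, v, hv, hs⟩, v, hv, rfl⟩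
      · exact absurd (hp a ha _ hv) hs.not_gt

theorem algAutoreduced_insert {A : Set (MvPolynomial σ k)} (hA : AlgAutoreduced A)
    {p : MvPolynomial σ k} {u : σ} (hu : IsLeader p u) (hp : ∀ a ∈ A, AlgReduced p a) :
    AlgAutoreduced ({a ∈ A | ∃ w, IsLeader a w ∧ w < u} ∪ {p}) := by
  constructor
  · rintro f (hf | rfl)
    · exact hA.1 f hf.1
    · exact hu.nonempty
  · rintro f (hf | rfl) g (hg | rfl) hne
    · exact hA.2 f hf.1 g hg.1 hne
    · obtain ⟨-, w, hw, hlt⟩ := hf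
      intro v hv
      obtain rfl := hv.unique hu
      rw [degreeOf_eq_zero_of_notMem (hw.notMem_vars_of_lt hlt)]
      exact hu.degreeOf_pos
    · exact hp g hg.1
    · exact absurd rfl hne

/-- Take `p` at the first difference of ranks. An element of `A` of lower rank shares its rank with
another element of `B`, with respect to which `p` is reduced; one of higher rank has a leader absent
from `p` or a larger degree in `u`. The last clause serves partial reducedness in the differential
case. -/
theorem exists_reduced_of_lowerRank {A B : Set (MvPolynomial σ k)} (hB : AlgAutoreduced B)
    (h : LowerRank B A) : ∃ p ∈ B, ∃ u, IsLeader p u ∧ ∀ a ∈ A, AlgReduced p a ∧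
      ∀ v, IsLeader a v → v < u → ∃ b ∈ B, p ≠ b ∧ IsLeader b v := by
  obtain ⟨_, ⟨p, hp, u, hu, rfl⟩, hrA, hr⟩ := h
  have key : ∀ a ∈ A, ∀ v, IsLeader a v → toLex (v, a.degreeOf v) < toLex (u, p.degreeOf u) →
      ∃ b ∈ B, p ≠ b ∧ IsLeader b v ∧ b.degreeOf v = a.degreeOf v := by
    intro a ha v hv hlt
    obtain ⟨b, hb, w, hw, h⟩ := (hr _ hlt).2 ⟨a, ha, v, hv, rfl⟩
    obtain ⟨rfl, h⟩ := Prod.mk.inj (toLex.injective h)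
    refine ⟨b, hb, ?_, hw, h.symm⟩
    rintro rfl
    obtain rfl := hw.unique hu
    rw [h] at hlt
    exact lt_irrefl _ hlt
  refine ⟨p, hp, u, hu, fun a ha => ⟨fun v hv => ?_, fun v hv hlt => ?_⟩⟩
  · rcases lt_trichotomy (toLex (v, a.degreeOf v)) (toLex (u, p.degreeOf u)) with hlt | heq | hgt
    · obtain ⟨b, hb, hne, hbv, hd⟩ := key a ha v hv hlt
      rw [← hd]
      exact hB.2 p hp b hb hne v hbv
    · exact absurd ⟨a, ha, v, hv, heq.symm⟩ hrA
    · rw [Prod.Lex.toLex_lt_toLex] at hgt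
      rcases hgt with hgt | ⟨heq, hgt⟩
      · rw [degreeOf_eq_zero_of_notMem (hu.notMem_vars_of_lt hgt)]
        exact hv.degreeOf_pos
      · simp only at heq hgt
        subst heq
        exact hgt
  · obtain ⟨b, hb, hne, hbv, -⟩ := key a ha v hv (Prod.Lex.toLex_lt_toLex.2 (Or.inl hlt))
    exact ⟨b, hb, hne, hbv⟩

theorem isAlgCharSet_iff {J : Ideal (MvPolynomial σ k)} (h1 : 1 ∉ J)
    {A : Set (MvPolynomial σ k)} : IsAlgCharSet J A ↔
      AlgAutoreduced A ∧ A ⊆ J ∧ ∀ p ∈ J, (∀ a ∈ A, AlgReduced p a) → p = 0 := by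
  constructor
  · rintro ⟨hA, hAJ, hmin⟩
    refine ⟨hA, hAJ, fun p hp hred => ?_⟩
    by_contra hp0
    by_cases hv : p.vars.Nonempty
    · obtain ⟨u, hu⟩ := exists_isLeader hv
      refine hmin _ (algAutoreduced_insert hA hu hred) ?_ (lowerRank_of_reduced hu hred)
      rintro f (hf | rfl)
      exacts [hAJ hf.1, hp]
    · exact h1 (one_mem_of_vars_empty hp hp0 hv)
  · rintro ⟨hA, hAJ, hz⟩
    refine ⟨hA, hAJ, fun B hB hBJ hlow => ?_⟩
    obtain ⟨p, hp, u, hu, h⟩ := exists_reduced_of_lowerRank hB hlow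
    exact hu.ne_zero (hz p (hBJ hp) fun a ha => (h a ha).1)

/-- One inclusion is automatic: the pseudo-remainder of an element of `J` is reduced and in `J`,
hence 0. The other amounts to cancelling initials and separants modulo `J`. -/
theorem isAlgCharacterizing_iff [WellFoundedLT σ] {J : Ideal (MvPolynomial σ k)} (h1 : 1 ∉ J)
    {A : Set (MvPolynomial σ k)} : IsAlgCharacterizing J A ↔
      AlgAutoreduced A ∧ A ⊆ J ∧ (∀ p ∈ J, (∀ a ∈ A, AlgReduced p a) → p = 0) ∧
        ∀ h ∈ HSet A, IsNZDMod J h := by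
  rw [IsAlgCharacterizing, isAlgCharSet_iff h1]
  constructor
  · rintro ⟨⟨hA, hAJ, hz⟩, hJ⟩
    refine ⟨hA, hAJ, hz, fun h hh => ?_⟩
    rw [hJ]
    exact isNZDMod_saturation _ (Submonoid.subset_closure hh)
  · rintro ⟨hA, hAJ, hz, hn⟩
    refine ⟨⟨hA, hAJ, hz⟩, le_antisymm (fun p hp => ?_) (saturation_le (Ideal.span_le.2 hAJ) hn)⟩
    obtain ⟨g, hg, hred⟩ := exists_isAlgRem hA.triangular.2 p
    obtain ⟨s, hs, hsp⟩ := algRem_exists_mul hg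
    rw [hz g (algRem_mem hAJ hg hp) hred, sub_zero] at hsp
    exact ⟨s, hs, hsp⟩

end CharacteristicSets
end DiffAlg

namespace DiffAlg
open MvPolynomial

/-! ### Transport between k[Z] and the ambient polynomial ring -/

section Subring

variable {σ : Type*} [LinearOrder σ] {k : Type*} [Field k] {Z : Set σ}

omit [LinearOrder σ] in
theorem degreeOf_rename_val (f : MvPolynomial Z k) (u : Z) :
    (rename (Subtype.val : Z → σ) f).degreeOf (u : σ) = f.degreeOf u :=
  degreeOf_rename_of_injective Subtype.val_injective u

omit [LinearOrder σ] in
theorem mem_vars_rename_val {f : MvPolynomial Z k} {u : Z} :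
    (u : σ) ∈ (rename (Subtype.val : Z → σ) f).vars ↔ u ∈ f.vars := by
  rw [mem_vars_iff_degreeOf_ne_zero, mem_vars_iff_degreeOf_ne_zero, degreeOf_rename_val]

omit [LinearOrder σ] in
theorem rename_val_mem_supported (f : MvPolynomial Z k) :
    rename (Subtype.val : Z → σ) f ∈ supported k Z := by
  rw [mem_supported]
  intro v hv
  obtain ⟨w, -, rfl⟩ := mem_vars_rename _ _ hv
  exact w.2

omit [LinearOrder σ] in
theorem exists_rename_val_eq {p : MvPolynomial σ k} (hp : p ∈ supported k Z) :
    ∃ f : MvPolynomial Z k, rename (Subtype.val : Z → σ) f = p :=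
  exists_rename_eq_of_vars_subset_range p _ Subtype.val_injective
    (by simpa using mem_supported.1 hp)

theorem isLeader_rename_val {f : MvPolynomial Z k} {u : Z} :
    IsLeader (rename (Subtype.val : Z → σ) f) u ↔ IsLeader f u := by
  refine and_congr mem_vars_rename_val ⟨fun h v hv => h v (mem_vars_rename_val.2 hv), ?_⟩
  intro h v hv
  obtain ⟨w, hw, rfl⟩ := mem_vars_rename _ _ hv
  exact h w hw

theorem IsLeader.exists_of_rename_val {f : MvPolynomial Z k} {w : σ}
    (h : IsLeader (rename (Subtype.val : Z → σ) f) w) : ∃ u : Z, u = w ∧ IsLeader f u := by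
  obtain ⟨u, -, rfl⟩ := mem_vars_rename _ _ h.1
  exact ⟨u, rfl, isLeader_rename_val.1 h⟩

theorem coeffAt_rename_val (u : Z) (d : ℕ) (f : MvPolynomial Z k) :
    coeffAt (u : σ) d (rename (Subtype.val : Z → σ) f) =
      rename (Subtype.val : Z → σ) (coeffAt u d f) := by
  have h : (toUni (k := k) (u : σ)).comp (rename (Subtype.val : Z → σ)) =
      (Polynomial.mapAlgHom (rename (Subtype.val : Z → σ))).comp (toUni u) := by
    ext v : 1
    by_cases hv : v = u
    · subst hv; simp [toUni]
    · simp [toUni, hv, Subtype.val_injective.ne hv]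
  have := congr_arg (fun p => p.coeff d) (DFunLike.congr_fun h f)
  simpa [coeff_toUni] using this

omit [LinearOrder σ] in
theorem vars_nonempty_rename_val {f : MvPolynomial Z k} :
    (rename (Subtype.val : Z → σ) f).vars.Nonempty ↔ f.vars.Nonempty := by
  constructor
  · rintro ⟨v, hv⟩
    obtain ⟨w, hw, -⟩ := mem_vars_rename _ _ hv
    exact ⟨w, hw⟩
  · rintro ⟨v, hv⟩
    exact ⟨v, mem_vars_rename_val.2 hv⟩

theorem initial_rename_val (f : MvPolynomial Z k) :
    initial (rename (Subtype.val : Z → σ) f) = rename (Subtype.val : Z → σ) (initial f) := by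
  by_cases h : f.vars.Nonempty
  · obtain ⟨u, hu⟩ := exists_isLeader h
    rw [hu.initial_eq, (isLeader_rename_val.2 hu).initial_eq, coeffAt_rename_val,
      degreeOf_rename_val]
  · rw [initial, initial, dif_neg h, dif_neg (by rwa [vars_nonempty_rename_val])]

theorem separant_rename_val (f : MvPolynomial Z k) :
    separant (rename (Subtype.val : Z → σ) f) = rename (Subtype.val : Z → σ) (separant f) := by
  by_cases h : f.vars.Nonempty
  · obtain ⟨u, hu⟩ := exists_isLeader h
    rw [hu.separant_eq, (isLeader_rename_val.2 hu).separant_eq,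
      pderiv_rename Subtype.val_injective]
  · rw [separant, separant, dif_neg h, dif_neg (by rwa [vars_nonempty_rename_val]), map_zero]

theorem HSet_image_rename_val (A : Set (MvPolynomial Z k)) :
    HSet (rename (Subtype.val : Z → σ) '' A) = rename (Subtype.val : Z → σ) '' HSet A := by
  rw [HSet, HSet, Set.image_union, Set.image_image, Set.image_image, Set.image_image,
    Set.image_image]
  simp only [initial_rename_val, separant_rename_val]

theorem algReduced_rename_val {f g : MvPolynomial Z k} :
    AlgReduced (rename (Subtype.val : Z → σ) f) (rename (Subtype.val : Z → σ) g) ↔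
      AlgReduced f g := by
  constructor
  · intro h u hu
    have := h u (isLeader_rename_val.2 hu)
    rwa [degreeOf_rename_val, degreeOf_rename_val] at this
  · intro h w hw
    obtain ⟨u, rfl, hu⟩ := hw.exists_of_rename_val
    rw [degreeOf_rename_val, degreeOf_rename_val]
    exact h u hu

theorem algAutoreduced_image_rename_val {A : Set (MvPolynomial Z k)} :
    AlgAutoreduced (rename (Subtype.val : Z → σ) '' A) ↔ AlgAutoreduced A := by
  have hinj := rename_injective (R := k) (Subtype.val : Z → σ) Subtype.val_injective
  simp only [AlgAutoreduced, Set.forall_mem_image, vars_nonempty_rename_val, hinj.ne_iff,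
    algReduced_rename_val]

theorem IsLexMonic.rename_val {f : MvPolynomial Z k} (h : IsLexMonic f) :
    IsLexMonic (rename (Subtype.val : Z → σ) f) := by
  classical
  obtain ⟨s, hs, h1, h⟩ := h
  have hmap : ∀ (t : Z →₀ ℕ) (u : Z), t.mapDomain Subtype.val (u : σ) = t u := fun t u =>
    Finsupp.mapDomain_apply Subtype.val_injective t u
  refine ⟨s.mapDomain Subtype.val, ?_, ?_, ?_⟩
  · rw [mem_support_iff, coeff_rename_mapDomain _ Subtype.val_injective]
    exact mem_support_iff.1 hs
  · rw [coeff_rename_mapDomain _ Subtype.val_injective, h1]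
  · intro t ht hts
    rw [support_rename_of_injective Subtype.val_injective, Finset.mem_image] at ht
    obtain ⟨t, ht, rfl⟩ := ht
    obtain ⟨u, hu, hv⟩ := h t ht (by rintro rfl; exact hts rfl)
    refine ⟨u, by rwa [hmap, hmap], fun v huv => ?_⟩
    by_cases hvZ : v ∈ Z
    · have := hv ⟨v, hvZ⟩ huv
      rw [← hmap, ← hmap] at this
      exact this
    · rw [Finsupp.mapDomain_of_notMem_range, Finsupp.mapDomain_of_notMem_range] <;> simpa using hvZ

end Subring

section Restrict

variable {k : Type*} [Field k] {m n : ℕ} [LinearOrder (DVar m n)] {Z : Set (DVar m n)}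

/-- Restated in the ambient ring, where elements of `A` can be divided into elements of `I`.
Cancellation is required only on polynomials in the variables `Z`. -/
theorem isAlgCharacterizing_restrictIdeal_iff [WellFoundedLT (DVar m n)]
    {I : Ideal (MvPolynomial (DVar m n) k)} (h1 : 1 ∉ I) {A : Set (MvPolynomial Z k)} :
    IsAlgCharacterizing (restrictIdeal I Z) A ↔ AlgAutoreduced (liftSet A) ∧ liftSet A ⊆ I ∧
      (∀ p ∈ I, p ∈ supported k Z → (∀ a ∈ liftSet A, AlgReduced p a) → p = 0) ∧
      ∀ h ∈ HSet (liftSet A), ∀ p ∈ supported k Z, h * p ∈ I → p ∈ I := by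
  have hmem : ∀ {p : MvPolynomial Z k}, p ∈ restrictIdeal I Z ↔ rename Subtype.val p ∈ I :=
    Iff.rfl
  have hinj := rename_injective (R := k) (Subtype.val : Z → DVar m n) Subtype.val_injective
  rw [isAlgCharacterizing_iff (by rwa [hmem, map_one])]
  unfold liftSet
  rw [algAutoreduced_image_rename_val, HSet_image_rename_val]
  refine and_congr Iff.rfl (and_congr ?_ (and_congr ?_ ?_))
  · rw [Set.image_subset_iff]; rfl
  · constructor
    · intro h p hp hps hred
      obtain ⟨p, rfl⟩ := exists_rename_val_eq hps
      rw [h p hp fun a ha => algReduced_rename_val.1 (hred _ ⟨a, ha, rfl⟩), map_zero]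
    · intro h p hp hred
      refine hinj ?_
      rw [map_zero]
      refine h _ hp (rename_val_mem_supported p) ?_
      rintro _ ⟨a, ha, rfl⟩
      exact algReduced_rename_val.2 (hred a ha)
  · constructor
    · rintro h _ ⟨b, hb, rfl⟩ p hps hp
      obtain ⟨p, rfl⟩ := exists_rename_val_eq hps
      rw [← map_mul] at hp
      exact h b hb p hp
    · intro h b hb p hp
      refine h _ ⟨b, hb, rfl⟩ _ (rename_val_mem_supported p) ?_
      rw [← map_mul]
      exact hp

end Restrict
end DiffAlg

namespace DiffAlg
open MvPolynomial

/-! ### Derivative operators and rankings -/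

section Ranking

variable {m n : ℕ}

@[simp] theorem DVar.act_zero (u : DVar m n) : u.act 0 = u := by simp [DVar.act]

theorem DVar.act_act (u : DVar m n) (θ ψ : Fin m →₀ ℕ) : (u.act θ).act ψ = u.act (ψ + θ) := by
  simp [DVar.act, add_assoc]

theorem DVar.act_injective (θ : Fin m →₀ ℕ) : Function.Injective (DVar.act (n := n) θ) := by
  intro u v h
  simp only [DVar.act, DVar.mk.injEq, add_right_inj] at h
  exact DVar.ext h.1 h.2

theorem DVar.act_eq_self_iff {u : DVar m n} {θ : Fin m →₀ ℕ} : u.act θ = u ↔ θ = 0 := by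
  constructor
  · intro h
    have := congr_arg DVar.op h
    simpa [DVar.act] using this
  · rintro rfl; simp

theorem theta_induction {P : (Fin m →₀ ℕ) → Prop} (h0 : P 0)
    (hs : ∀ θ i, P θ → P (θ + Finsupp.single i 1)) (θ : Fin m →₀ ℕ) : P θ := by
  induction hd : θ.degree generalizing θ with
  | zero => rw [Finsupp.degree_eq_zero_iff] at hd; rwa [hd]
  | succ d ih =>
    have hne : θ ≠ 0 := by rintro rfl; simp at hd
    obtain ⟨i, hi⟩ := Finsupp.ne_iff.1 hne
    have hle : Finsupp.single i 1 ≤ θ := by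
      rw [Finsupp.single_le_iff]
      exact Nat.one_le_iff_ne_zero.2 hi
    have h : θ = θ - Finsupp.single i 1 + Finsupp.single i 1 := (tsub_add_cancel_of_le hle).symm
    rw [h] at hd ⊢
    rw [map_add, Finsupp.degree_single] at hd
    exact hs _ _ (ih _ (by omega))

variable [LinearOrder (DVar m n)]

theorem IsRanking.lt_act (hr : IsRanking m n) {θ : Fin m →₀ ℕ} (hθ : θ ≠ 0) (u : DVar m n) :
    u < u.act θ :=
  lt_of_le_of_ne (hr.1 θ u) fun h => hθ (DVar.act_eq_self_iff.1 h.symm)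

theorem IsRanking.act_lt_act (hr : IsRanking m n) (θ : Fin m →₀ ℕ) {u v : DVar m n} (h : u < v) :
    u.act θ < v.act θ :=
  lt_of_le_of_ne (hr.2 θ v u h.le) fun e => h.ne (DVar.act_injective θ e)

/-- Dickson's lemma: a descending sequence would contain a term that is a derivative of an earlier
one, hence not lower than it. -/
theorem IsRanking.wellFoundedLT (hr : IsRanking m n) : WellFoundedLT (DVar m n) := by
  refine ⟨RelEmbedding.wellFounded_iff_isEmpty.2 ⟨fun f => ?_⟩⟩
  have h1 : WellQuasiOrdered fun a b : Fin n => a = b := Finite.wellQuasiOrdered _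
  have h2 : WellQuasiOrdered fun a b : Fin m →₀ ℕ => a ≤ b := wellQuasiOrdered_le
  obtain ⟨i, j, hij, h⟩ := (h1.prod h2) fun i => ((f i).var, (f i).op)
  have hlt : f j < f i := f.map_rel_iff.2 hij
  have : f j = (f i).act ((f j).op - (f i).op) := by
    ext1
    · exact (tsub_add_cancel_of_le h.2).symm
    · exact h.1.symm
  rw [this] at hlt
  exact (hr.1 _ _).not_gt hlt

end Ranking

/-! ### Derivations of the differential polynomial ring -/

section Derivations

variable {k : Type*} [Field k] {m n : ℕ} (δ : Fin m → Derivation ℤ k k)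

theorem coeff_coeffDeriv {σ : Type*} (d : Derivation ℤ k k) (p : MvPolynomial σ k) (s : σ →₀ ℕ) :
    (coeffDeriv d p).coeff s = d (p.coeff s) := by
  classical
  change (∑ t ∈ p.support, monomial t (d (p.coeff t))).coeff s = d (p.coeff s)
  rw [coeff_sum]
  simp only [coeff_monomial]
  rw [Finset.sum_ite_eq']
  split_ifs with h
  · rfl
  · rw [notMem_support_iff.mp h, map_zero]

theorem dpDeriv_C (i : Fin m) (a : k) :
    dpDeriv δ i (C a : MvPolynomial (DVar m n) k) = C (δ i a) := by
  have h : coeffDeriv (δ i) (C a : MvPolynomial (DVar m n) k) = C (δ i a) := by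
    classical
    ext s
    rw [coeff_coeffDeriv, coeff_C, coeff_C]
    split_ifs <;> simp
  rw [dpDeriv, Derivation.add_apply, h, Derivation.restrictScalars_apply, derivation_C, add_zero]

theorem dpDeriv_X (i : Fin m) (u : DVar m n) :
    dpDeriv δ i (X u : MvPolynomial (DVar m n) k) = X (u.act (Finsupp.single i 1)) := by
  have h : coeffDeriv (δ i) (X u : MvPolynomial (DVar m n) k) = 0 := by
    classical
    ext s
    rw [coeff_coeffDeriv, coeff_X, coeff_zero]
    split_ifs <;> simp
  rw [dpDeriv, Derivation.add_apply, h, Derivation.restrictScalars_apply, mkDerivation_X, zero_add]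

theorem dpDeriv_mul (i : Fin m) (f g : MvPolynomial (DVar m n) k) :
    dpDeriv δ i (f * g) = f * dpDeriv δ i g + g * dpDeriv δ i f := by
  rw [Derivation.leibniz, smul_eq_mul, smul_eq_mul]

theorem dpDeriv_comm (hδ : ∀ i j a, δ i (δ j a) = δ j (δ i a)) (i j : Fin m)
    (f : MvPolynomial (DVar m n) k) : dpDeriv δ i (dpDeriv δ j f) = dpDeriv δ j (dpDeriv δ i f) := by
  induction f using MvPolynomial.induction_on with
  | C a => simp only [dpDeriv_C, hδ i j]
  | add p q hp hq => simp only [map_add, hp, hq]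
  | mul_X p u hp =>
    simp only [dpDeriv_mul, dpDeriv_X, map_add, hp, DVar.act_act,
      add_comm (Finsupp.single i 1) (Finsupp.single j 1)]
    ring

theorem thetaOp_zero (f : MvPolynomial (DVar m n) k) : thetaOp δ 0 f = f := by
  unfold thetaOp
  induction List.finRange m with
  | nil => rfl
  | cons i l ih => simp

/-- `thetaOp` applies the derivations in a fixed order, so the extra one must be commuted outwards
past those preceding it in the list. -/
theorem thetaOp_add_single (hδ : ∀ i j a, δ i (δ j a) = δ j (δ i a)) (θ : Fin m →₀ ℕ) (i : Fin m)
    (f : MvPolynomial (DVar m n) k) :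
    thetaOp δ (θ + Finsupp.single i 1) f = dpDeriv δ i (thetaOp δ θ f) := by
  have h0 : ∀ l : List (Fin m), i ∉ l →
      l.foldr (fun j g => (dpDeriv δ j)^[(θ + Finsupp.single i 1 : Fin m →₀ ℕ) j] g) f =
        l.foldr (fun j g => (dpDeriv δ j)^[θ j] g) f := by
    intro l hi
    induction l with
    | nil => rfl
    | cons j l ih =>
      have hij : i ≠ j := fun h => hi (h ▸ List.mem_cons_self)
      rw [List.foldr_cons, List.foldr_cons, ih fun h => hi (List.mem_cons_of_mem _ h)]
      simp [hij]
  have h1 : ∀ l : List (Fin m), l.Nodup → i ∈ l →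
      l.foldr (fun j g => (dpDeriv δ j)^[(θ + Finsupp.single i 1 : Fin m →₀ ℕ) j] g) f =
        dpDeriv δ i (l.foldr (fun j g => (dpDeriv δ j)^[θ j] g) f) := by
    intro l hl hi
    induction l with
    | nil => simp at hi
    | cons j l ih =>
      rw [List.nodup_cons] at hl
      rw [List.foldr_cons, List.foldr_cons]
      by_cases hij : i = j
      · subst hij
        rw [h0 l hl.1, Finsupp.add_apply, Finsupp.single_eq_same, Function.iterate_succ_apply']
      · rw [ih hl.2 ((List.mem_cons.1 hi).resolve_left hij)]
        have hc : Function.Commute (dpDeriv δ i : MvPolynomial (DVar m n) k → _) (dpDeriv δ j) :=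
          fun f => dpDeriv_comm δ hδ i j f
        have hj : (θ + Finsupp.single i 1 : Fin m →₀ ℕ) j = θ j := by simp [hij]
        rw [hj]
        exact ((hc.iterate_right (θ j)) _).symm
  exact h1 _ (List.nodup_finRange m) (List.mem_finRange i)

theorem thetaOp_single (hδ : ∀ i j a, δ i (δ j a) = δ j (δ i a)) (i : Fin m)
    (f : MvPolynomial (DVar m n) k) : thetaOp δ (Finsupp.single i 1) f = dpDeriv δ i f := by
  rw [← zero_add (Finsupp.single i 1), thetaOp_add_single δ hδ, thetaOp_zero]

theorem dpDeriv_mem_thetaSet (hδ : ∀ i j a, δ i (δ j a) = δ j (δ i a))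
    {F : Set (MvPolynomial (DVar m n) k)} {f : MvPolynomial (DVar m n) k} (hf : f ∈ thetaSet δ F)
    (i : Fin m) : dpDeriv δ i f ∈ thetaSet δ F := by
  obtain ⟨g, hg, θ, rfl⟩ := hf
  exact ⟨g, hg, _, (thetaOp_add_single δ hδ θ i g).symm⟩

theorem subset_thetaSet (F : Set (MvPolynomial (DVar m n) k)) : F ⊆ thetaSet δ F := fun f hf =>
  ⟨f, hf, 0, (thetaOp_zero δ f).symm⟩

theorem dpDeriv_mem_span {S T : Set (MvPolynomial (DVar m n) k)} (i : Fin m) (hST : S ⊆ T)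
    (h : ∀ f ∈ S, dpDeriv δ i f ∈ Ideal.span T) {f : MvPolynomial (DVar m n) k}
    (hf : f ∈ Ideal.span S) : dpDeriv δ i f ∈ Ideal.span T := by
  induction hf using Submodule.span_induction with
  | mem x hx => exact h x hx
  | zero => rw [map_zero]; exact Ideal.zero_mem _
  | add x y _ _ hx hy => rw [map_add]; exact Ideal.add_mem _ hx hy
  | smul a x hx' hx =>
    rw [smul_eq_mul, dpDeriv_mul]
    exact Ideal.add_mem _ (Ideal.mul_mem_left _ _ hx)
      (Ideal.mul_mem_right _ _ (Ideal.span_mono hST hx'))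

theorem dpDeriv_mem_saturation {J J' : Ideal (MvPolynomial (DVar m n) k)}
    {H : Set (MvPolynomial (DVar m n) k)} (i : Fin m) (hJ : J ≤ J')
    (h : ∀ f ∈ J, dpDeriv δ i f ∈ J') {f : MvPolynomial (DVar m n) k} (hf : f ∈ saturation J H) :
    dpDeriv δ i f ∈ saturation J' H := by
  obtain ⟨s, hs, hsf⟩ := hf
  refine ⟨s * s, Submonoid.mul_mem _ hs hs, ?_⟩
  -- The square of `s` absorbs the Leibniz term: s²δf = s δ(sf) − δ(s)(sf).
  have h2 := h _ hsf
  rw [dpDeriv_mul] at h2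
  have h3 : s * s * dpDeriv δ i f = s * (s * dpDeriv δ i f + f * dpDeriv δ i s) -
      dpDeriv δ i s * (s * f) := by ring
  rw [h3]
  exact J'.sub_mem (J'.mul_mem_left _ h2) (J'.mul_mem_left _ (hJ hsf))

theorem dpDeriv_mem_supported {S T : Set (DVar m n)} (i : Fin m) (hST : S ⊆ T)
    (h : ∀ u ∈ S, u.act (Finsupp.single i 1) ∈ T) {f : MvPolynomial (DVar m n) k}
    (hf : f ∈ supported k S) : dpDeriv δ i f ∈ supported k T := by
  induction hf using Algebra.adjoin_induction with
  | mem x hx =>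
    obtain ⟨u, hu, rfl⟩ := hx
    rw [dpDeriv_X]
    exact X_mem_supported.2 (h u hu)
  | algebraMap a => rw [algebraMap_eq, dpDeriv_C]; exact Subalgebra.algebraMap_mem _ _
  | add x y _ _ hx hy => rw [map_add]; exact Subalgebra.add_mem _ hx hy
  | mul x y hx' hy' hx hy =>
    rw [dpDeriv_mul]
    exact Subalgebra.add_mem _ (Subalgebra.mul_mem _ (supported_mono hST hx') hy)
      (Subalgebra.mul_mem _ (supported_mono hST hy') hx)

variable [LinearOrder (DVar m n)]

theorem dpDeriv_mem_satDiffIdeal (hδ : ∀ i j a, δ i (δ j a) = δ j (δ i a))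
    {A : Set (MvPolynomial (DVar m n) k)} {f : MvPolynomial (DVar m n) k}
    (hf : f ∈ satDiffIdeal δ A) (i : Fin m) : dpDeriv δ i f ∈ satDiffIdeal δ A :=
  dpDeriv_mem_saturation δ i le_rfl (fun _ hg => dpDeriv_mem_span δ i subset_rfl
    (fun _ hg => Ideal.subset_span (dpDeriv_mem_thetaSet δ hδ hg i)) hg) hf

theorem thetaOp_mem_satDiffIdeal (hδ : ∀ i j a, δ i (δ j a) = δ j (δ i a))
    {A : Set (MvPolynomial (DVar m n) k)} {f : MvPolynomial (DVar m n) k}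
    (hf : f ∈ satDiffIdeal δ A) (θ : Fin m →₀ ℕ) : thetaOp δ θ f ∈ satDiffIdeal δ A := by
  induction θ using theta_induction with
  | h0 => rwa [thetaOp_zero]
  | hs θ i ih => rw [thetaOp_add_single δ hδ]; exact dpDeriv_mem_satDiffIdeal δ hδ ih i

theorem thetaSet_subset_satDiffIdeal (A : Set (MvPolynomial (DVar m n) k)) :
    thetaSet δ A ⊆ satDiffIdeal δ A := fun _ hf => le_saturation _ _ (Ideal.subset_span hf)

/-! ### Leaders of derivatives -/

theorem exists_dpDeriv_eq (hr : IsRanking m n) (i : Fin m) {u : DVar m n}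
    {f : MvPolynomial (DVar m n) k} (hf : f ∈ supported k (Set.Iic u)) :
    ∃ t ∈ supported k (Set.Iio (u.act (Finsupp.single i 1))),
      dpDeriv δ i f = pderiv u f * X (u.act (Finsupp.single i 1)) + t := by
  have hlt : u < u.act (Finsupp.single i 1) := hr.lt_act (by simp) u
  have hmono : supported k (Set.Iic u) ≤ supported k (Set.Iio (u.act (Finsupp.single i 1))) :=
    supported_mono fun v hv => lt_of_le_of_lt hv hlt
  induction hf using Algebra.adjoin_induction with
  | mem x hx =>
    obtain ⟨v, hv, rfl⟩ := hx
    rcases (Set.mem_Iic.1 hv).eq_or_lt with rfl | hv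
    · exact ⟨0, Subalgebra.zero_mem _, by rw [dpDeriv_X, pderiv_X_self, one_mul, add_zero]⟩
    · exact ⟨X (v.act _), X_mem_supported.2 (hr.act_lt_act _ hv),
        by rw [dpDeriv_X, pderiv_X_of_ne hv.ne, zero_mul, zero_add]⟩
  | algebraMap a =>
    exact ⟨C (δ i a), Subalgebra.algebraMap_mem _ _,
      by rw [algebraMap_eq, dpDeriv_C, pderiv_C, zero_mul, zero_add]⟩
  | add x y _ _ hx hy =>
    obtain ⟨s, hs, hx⟩ := hx
    obtain ⟨t, ht, hy⟩ := hy
    exact ⟨s + t, Subalgebra.add_mem _ hs ht, by rw [map_add, map_add, hx, hy]; ring⟩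
  | mul x y hx' hy' hx hy =>
    obtain ⟨s, hs, hx⟩ := hx
    obtain ⟨t, ht, hy⟩ := hy
    exact ⟨x * t + y * s, Subalgebra.add_mem _ (Subalgebra.mul_mem _ (hmono hx') ht)
      (Subalgebra.mul_mem _ (hmono hy') hs), by rw [dpDeriv_mul, pderiv_mul, hx, hy]; ring⟩

theorem IsLeader.separant_mem_supported {f : MvPolynomial (DVar m n) k} {u : DVar m n}
    (hu : IsLeader f u) : separant f ∈ supported k (Set.Iic u) := by
  rw [hu.separant_eq]
  exact pderiv_mem_supported hu.mem_supported u

/-- The first differentiation makes `f` linear in the new leader, with the separant as coefficient;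
every further one keeps that coefficient and moves the leader on. -/
theorem exists_thetaOp_eq (hδ : ∀ i j a, δ i (δ j a) = δ j (δ i a)) (hr : IsRanking m n)
    {u : DVar m n} {f : MvPolynomial (DVar m n) k} (hu : IsLeader f u) (θ : Fin m →₀ ℕ) :
    θ ≠ 0 → ∃ t ∈ supported k (Set.Iio (u.act θ)),
      thetaOp δ θ f = separant f * X (u.act θ) + t := by
  induction θ using theta_induction with
  | h0 => exact fun h => absurd rfl h
  | hs θ i ih =>
    intro _
    have hact : (u.act θ).act (Finsupp.single i 1) = u.act (θ + Finsupp.single i 1) := by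
      rw [DVar.act_act, add_comm]
    by_cases hθ : θ = 0
    · subst hθ
      rw [thetaOp_add_single δ hδ, thetaOp_zero, zero_add, hu.separant_eq]
      exact exists_dpDeriv_eq δ hr i hu.mem_supported
    · obtain ⟨t, ht, h⟩ := ih hθ
      have hu1 : u < u.act θ := hr.lt_act hθ u
      have hu2 : u.act θ < u.act (θ + Finsupp.single i 1) := by
        rw [← hact]; exact hr.lt_act (by simp) _
      have hX : (X (u.act θ) : MvPolynomial (DVar m n) k) ∈
          supported k (Set.Iio (u.act (θ + Finsupp.single i 1))) := X_mem_supported.2 hu2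
      refine ⟨X (u.act θ) * dpDeriv δ i (separant f) + dpDeriv δ i t, Subalgebra.add_mem _
        (Subalgebra.mul_mem _ hX (dpDeriv_mem_supported δ i ?_ ?_ hu.separant_mem_supported))
        (dpDeriv_mem_supported δ i ?_ ?_ ht), ?_⟩
      · exact fun v hv => (lt_of_le_of_lt hv hu1).trans hu2
      · intro v hv
        rw [← hact]
        exact hr.act_lt_act _ (lt_of_le_of_lt hv hu1)
      · exact fun v hv => lt_trans hv hu2
      · intro v hv
        rw [← hact]
        exact hr.act_lt_act _ hv
      · rw [thetaOp_add_single δ hδ, h, map_add, dpDeriv_mul, dpDeriv_X, hact]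
        ring

theorem isLeader_mul_X_add {σ : Type*} [LinearOrder σ] {s t : MvPolynomial σ k} {w : σ}
    (hs : s ∈ supported k (Set.Iio w)) (ht : t ∈ supported k (Set.Iio w)) (hs0 : s ≠ 0) :
    IsLeader (s * X w + t) w ∧ (s * X w + t).degreeOf w = 1 ∧ initial (s * X w + t) = s ∧
      separant (s * X w + t) = s := by
  have hw : ∀ {p : MvPolynomial σ k}, p ∈ supported k (Set.Iio w) → w ∉ p.vars := fun hp h =>
    lt_irrefl w (mem_supported.1 hp h)
  have huni : toUni w (s * X w + t) = Polynomial.C s * Polynomial.X + Polynomial.C t := by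
    rw [map_add, map_mul, toUni_X_self, toUni_of_notMem (hw hs), toUni_of_notMem (hw ht)]
  have hdeg : (s * X w + t).degreeOf w = 1 := by
    rw [← natDegree_toUni, huni, Polynomial.natDegree_linear hs0]
  have hlead : IsLeader (s * X w + t) w := by
    refine isLeader_of_mem_supported (Subalgebra.add_mem _ (Subalgebra.mul_mem _
      (supported_mono Set.Iio_subset_Iic_self hs) (X_mem_supported.2 le_rfl))
      (supported_mono Set.Iio_subset_Iic_self ht)) (by omega)
  have hc : coeffAt w 1 (s * X w + t) = s := by
    rw [← coeff_toUni, huni]; simp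
  exact ⟨hlead, hdeg, by rw [hlead.initial_eq, hdeg, hc],
    by rw [hlead.separant_eq, pderiv_of_degreeOf_eq_one hdeg, hc]⟩

theorem IsLeader.separant_ne_zero {σ : Type*} [LinearOrder σ] [CharZero k] {f : MvPolynomial σ k}
    {u : σ} (hu : IsLeader f u) : separant f ≠ 0 := by
  rw [hu.separant_eq]
  intro h
  have h2 := toUni_pderiv u f
  rw [h, map_zero] at h2
  have := Polynomial.derivative_eq_zero.1 h2.symm
  rw [natDegree_toUni] at this
  exact hu.degreeOf_pos.ne' this

variable [CharZero k]

theorem isLeader_thetaOp (hδ : ∀ i j a, δ i (δ j a) = δ j (δ i a)) (hr : IsRanking m n)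
    {u : DVar m n} {f : MvPolynomial (DVar m n) k} (hu : IsLeader f u) {θ : Fin m →₀ ℕ}
    (hθ : θ ≠ 0) : IsLeader (thetaOp δ θ f) (u.act θ) ∧
      (thetaOp δ θ f).degreeOf (u.act θ) = 1 ∧ initial (thetaOp δ θ f) = separant f ∧
      separant (thetaOp δ θ f) = separant f := by
  obtain ⟨t, ht, h⟩ := exists_thetaOp_eq δ hδ hr hu θ hθ
  rw [h]
  exact isLeader_mul_X_add (supported_mono (fun v hv => lt_of_le_of_lt hv (hr.lt_act hθ u))
    hu.separant_mem_supported) ht hu.separant_ne_zero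

theorem IsLeader.thetaOp (hδ : ∀ i j a, δ i (δ j a) = δ j (δ i a)) (hr : IsRanking m n)
    {u : DVar m n} {f : MvPolynomial (DVar m n) k} (hu : IsLeader f u) (θ : Fin m →₀ ℕ) :
    IsLeader (thetaOp δ θ f) (u.act θ) := by
  by_cases hθ : θ = 0
  · subst hθ
    rwa [thetaOp_zero, DVar.act_zero]
  · exact (isLeader_thetaOp δ hδ hr hu hθ).1

/-- A proper derivative of `f` has the separant of `f` both as initial and as separant. -/
theorem HSet_thetaSet_subset (hδ : ∀ i j a, δ i (δ j a) = δ j (δ i a)) (hr : IsRanking m n)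
    {F : Set (MvPolynomial (DVar m n) k)} (hF : ∀ f ∈ F, f.vars.Nonempty) :
    HSet (thetaSet δ F) ⊆ HSet F := by
  rintro _ (⟨_, ⟨f, hf, θ, rfl⟩, rfl⟩ | ⟨_, ⟨f, hf, θ, rfl⟩, rfl⟩)
  all_goals
    obtain ⟨u, hu⟩ := exists_isLeader (hF f hf)
    by_cases hθ : θ = 0
  · subst hθ
    rw [thetaOp_zero]
    exact Or.inl ⟨f, hf, rfl⟩
  · rw [(isLeader_thetaOp δ hδ hr hu hθ).2.2.1]
    exact Or.inr ⟨f, hf, rfl⟩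
  · subst hθ
    rw [thetaOp_zero]
    exact Or.inr ⟨f, hf, rfl⟩
  · rw [(isLeader_thetaOp δ hδ hr hu hθ).2.2.2]
    exact Or.inr ⟨f, hf, rfl⟩

theorem leaders_thetaSet (hδ : ∀ i j a, δ i (δ j a) = δ j (δ i a)) (hr : IsRanking m n)
    {F : Set (MvPolynomial (DVar m n) k)} (hF : ∀ f ∈ F, f.vars.Nonempty) :
    leaders (thetaSet δ F) = thetaVars (leaders F) := by
  ext v
  constructor
  · rintro ⟨_, ⟨f, hf, θ, rfl⟩, hv⟩
    obtain ⟨u, hu⟩ := exists_isLeader (hF f hf)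
    exact ⟨u, ⟨f, hf, hu⟩, θ, hv.unique (hu.thetaOp δ hδ hr θ)⟩
  · rintro ⟨u, ⟨f, hf, hu⟩, θ, rfl⟩
    exact ⟨_, ⟨f, hf, θ, rfl⟩, hu.thetaOp δ hδ hr θ⟩

end Derivations
end DiffAlg

namespace DiffAlg
open MvPolynomial

/-! ### Transversal derivations and initials in a saturated ideal -/

section DerivationTransversal

variable {σ : Type*} [LinearOrder σ] {k : Type*} [Field k]

/-- A vector field on the localisation at `M` that is transversal to the coordinate `u` and
tangent to the elements of `B`. -/
theorem exists_tangent [WellFoundedLT σ] {B : Set (MvPolynomial σ k)}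
    (hB : ∀ f ∈ B, ∀ g ∈ B, ∀ u, IsLeader f u → IsLeader g u → f = g)
    (hne : ∀ f ∈ B, f.vars.Nonempty) (M : Submonoid (MvPolynomial σ k))
    (hM : ∀ b ∈ B, separant b ∈ M) {u : σ} (hu : u ∉ leaders B) :
    ∃ D : Derivation k (MvPolynomial σ k) (Localization M), (∀ b ∈ B, D b = 0) ∧
      ∀ f ∈ supported k (Set.Iic u), D f = algebraMap _ _ (pderiv u f) := by
  classical
  -- The values on the variables come from well-founded recursion: 1 at `u`; at a leader `w` of some
  -- `b`, the solution of D b = 0, whose coefficient is the invertible separant; 0 elsewhere. Hence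
  -- everything below `u` is 0.
  let F : ∀ w : σ, (∀ x, x < w → Localization M) → Localization M := fun w e =>
    if w = u then 1 else
      if h : ∃ b ∈ B, IsLeader b w then
        -(Localization.mk 1 ⟨separant h.choose, hM _ h.choose_spec.1⟩ *
          mkDerivation k (fun x => if hx : x < w then e x hx else (0 : Localization M)) h.choose)
      else 0
  let e : σ → Localization M := WellFounded.fix (wellFounded_lt (α := σ)) F
  have he : ∀ w, e w = F w fun x _ => e x := fun w => WellFounded.fix_eq _ F w
  have heu : e u = 1 := by rw [he]; exact if_pos rfl
  have hlow : ∀ w, w < u → e w = 0 := by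
    intro w
    induction w using WellFoundedLT.induction with
    | ind w ih =>
      intro hw
      rw [he]
      simp only [F]
      rw [if_neg hw.ne]
      split_ifs with h
      · have : (fun x => if x < w then e x else (0 : Localization M)) = 0 := by
          funext x
          split_ifs with hx
          · exact ih x hx (hx.trans hw)
          · rfl
        simp only [dite_eq_ite, this]
        have h0 : mkDerivation k (0 : σ → Localization M) = 0 := derivation_ext fun i => by
          rw [mkDerivation_X]; rfl
        rw [h0, Derivation.zero_apply, mul_zero, neg_zero]
      · rfl
  refine ⟨mkDerivation k e, fun b hb => ?_, fun f hf => ?_⟩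
  · obtain ⟨w, hw⟩ := exists_isLeader (hne b hb)
    have hwu : w ≠ u := by rintro rfl; exact hu ⟨b, hb, hw⟩
    have hex : ∃ b ∈ B, IsLeader b w := ⟨b, hb, hw⟩
    have hch : hex.choose = b := hB _ hex.choose_spec.1 b hb w hex.choose_spec.2 hw
    set e' : σ → Localization M := fun x => if x < w then e x else 0 with he'
    -- D b splits into the contribution of the variables below `w` and that of `w` itself.
    have h1 : mkDerivation k e b = (mkDerivation k e' +
        (LinearMap.toSpanSingleton (MvPolynomial σ k) (Localization M) (e w)).compDer (pderiv w)) b := by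
      refine derivation_eq_of_forall_mem_vars fun x hx => ?_
      rw [Derivation.add_apply, mkDerivation_X, mkDerivation_X]
      rcases (hw.2 x hx).eq_or_lt with rfl | hlt
      · simp [he', LinearMap.toSpanSingleton_apply]
      · simp [he', hlt, LinearMap.toSpanSingleton_apply, pderiv_X_of_ne hlt.ne]
    have h2 : e w = -(Localization.mk 1 ⟨separant b, hM _ hb⟩ * mkDerivation k e' b) := by
      rw [he]
      simp only [F]
      rw [if_neg hwu, dif_pos hex]
      simp only [hch, dite_eq_ite, he']
    have h3 : algebraMap (MvPolynomial σ k) (Localization M) (separant b) *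
        Localization.mk 1 ⟨separant b, hM _ hb⟩ = 1 := by
      rw [← Localization.mk_one_eq_algebraMap, Localization.mk_mul, mul_one, one_mul]
      exact Localization.mk_self (⟨separant b, hM _ hb⟩ : M)
    rw [h1, Derivation.add_apply, Derivation.coe_comp]
    change _ + pderiv w b • e w = 0
    have hring : ∀ {S : Type _} [CommRing S] (x y z : S), x * y = 1 → z + x * -(y * z) = 0 := by
      intro S _ x y z h
      linear_combination -z * h
    rw [h2, ← hw.separant_eq, Algebra.smul_def]
    exact hring _ _ _ h3
  · have h1 : mkDerivation k e f =
        (LinearMap.toSpanSingleton (MvPolynomial σ k) (Localization M) 1).compDer (pderiv u) f := by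
      refine derivation_eq_of_forall_mem_vars fun x hx => ?_
      rw [mkDerivation_X]
      rcases (mem_supported.1 hf hx : x ≤ u).eq_or_lt with rfl | hlt
      · simp [LinearMap.toSpanSingleton_apply, heu]
      · simp [LinearMap.toSpanSingleton_apply, pderiv_X_of_ne hlt.ne, hlow x hlt]
    rw [h1]
    change pderiv u f • (1 : Localization M) = _
    rw [Algebra.smul_def, mul_one]

/-- The tangent derivation maps (B) into its extension to the localization. Applied to a multiple `s
* f` in (B), it gives s ∂f/∂u modulo that extension. -/
theorem pderiv_mem_saturation [WellFoundedLT σ] {B : Set (MvPolynomial σ k)}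
    (hB : Triangular B) {H : Set (MvPolynomial σ k)} (hH : ∀ b ∈ B, separant b ∈ H) {u : σ}
    (hu : u ∉ leaders B) {f : MvPolynomial σ k} (hf : f ∈ saturation (Ideal.span B) H)
    (hfu : f ∈ supported k (Set.Iic u)) : pderiv u f ∈ saturation (Ideal.span B) H := by
  set M := Submonoid.closure H with hM
  obtain ⟨D, hDB, hDu⟩ := exists_tangent hB.2 hB.1 M
    (fun b hb => Submonoid.subset_closure (hH b hb)) hu
  set 𝔞 := (Ideal.span B).map (algebraMap (MvPolynomial σ k) (Localization M)) with h𝔞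
  have hD : ∀ p ∈ Ideal.span B, D p ∈ 𝔞 := by
    intro p hp
    induction hp using Submodule.span_induction with
    | mem x hx => rw [hDB x hx]; exact 𝔞.zero_mem
    | zero => rw [map_zero]; exact 𝔞.zero_mem
    | add x y _ _ hx hy => rw [map_add]; exact 𝔞.add_mem hx hy
    | smul a x hx' hx =>
      rw [smul_eq_mul, Derivation.leibniz, Algebra.smul_def, Algebra.smul_def]
      exact 𝔞.add_mem (𝔞.mul_mem_left _ hx) (𝔞.mul_mem_right _ (Ideal.mem_map_of_mem _ hx'))
  obtain ⟨s, hs, hsf⟩ := hf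
  have hf𝔞 : algebraMap (MvPolynomial σ k) (Localization M) f ∈ 𝔞 :=
    (IsLocalization.algebraMap_mem_map_algebraMap_iff M _ _ _).2 ⟨s, hs, hsf⟩
  have h1 := hD _ hsf
  rw [Derivation.leibniz, hDu f hfu, Algebra.smul_def, Algebra.smul_def,
    𝔞.add_mem_iff_left (𝔞.mul_mem_right _ hf𝔞), ← map_mul,
    IsLocalization.algebraMap_mem_map_algebraMap_iff M] at h1
  obtain ⟨t, ht, h⟩ := h1
  exact ⟨t * s, Submonoid.mul_mem _ ht hs, by rwa [mul_assoc]⟩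

theorem initial_mem_saturation [WellFoundedLT σ] [CharZero k] {B : Set (MvPolynomial σ k)}
    (hB : Triangular B) {H : Set (MvPolynomial σ k)} (hH : ∀ b ∈ B, separant b ∈ H) {u : σ}
    (hu : u ∉ leaders B) {f : MvPolynomial σ k} (hf : f ∈ saturation (Ideal.span B) H)
    (hfu : IsLeader f u) : initial f ∈ saturation (Ideal.span B) H := by
  have key : ∀ j, (pderiv u)^[j] f ∈ saturation (Ideal.span B) H ∧
      (pderiv u)^[j] f ∈ supported k (Set.Iic u) := by
    intro j
    induction j with
    | zero => exact ⟨hf, hfu.mem_supported⟩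
    | succ j ih =>
      rw [Function.iterate_succ_apply']
      exact ⟨pderiv_mem_saturation hB hH hu ih.1 ih.2, pderiv_mem_supported ih.2 u⟩
  have h := (key (f.degreeOf u)).1
  rw [iterate_pderiv_eq, ← hfu.initial_eq] at h
  have hd : ((f.degreeOf u).factorial : k) ≠ 0 := by exact_mod_cast Nat.factorial_ne_zero _
  have := Ideal.mul_mem_left _ (C (((f.degreeOf u).factorial : k)⁻¹)) h
  rwa [← mul_assoc, ← C_mul, inv_mul_cancel₀ hd, C_1, one_mul] at this

end DerivationTransversal

/-! ### Coherence: from the differential ideal to a triangular section -/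

section Coherent

variable {k : Type*} [Field k] [CharZero k] {m n : ℕ} (δ : Fin m → Derivation ℤ k k)
  [LinearOrder (DVar m n)]

/-- The elements of `Θ C` with leader lower than `v`. -/
def thetaBelow (C : Set (MvPolynomial (DVar m n) k)) (v : DVar m n) :
    Set (MvPolynomial (DVar m n) k) :=
  {p ∈ thetaSet δ C | ∃ w, IsLeader p w ∧ w < v}

/-- Coherence is assumed at the least common derivative only; differentiating propagates it. The
Leibniz terms with differentiated separants are multiples of elements of ΘC whose leader lies below
the new bound. -/
theorem Coherent.thetaOp_mem (hδ : ∀ i j a, δ i (δ j a) = δ j (δ i a)) (hr : IsRanking m n)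
    {C : Set (MvPolynomial (DVar m n) k)} (hC : Coherent δ C) {f g : MvPolynomial (DVar m n) k}
    (hf : f ∈ C) (hg : g ∈ C) {u v : DVar m n} (hu : IsLeader f u) (hv : IsLeader g v)
    (huv : u.var = v.var) (φ : Fin m →₀ ℕ) :
    separant g * thetaOp δ (φ + (u.op ⊔ v.op - u.op)) f -
      separant f * thetaOp δ (φ + (u.op ⊔ v.op - v.op)) g ∈
        saturation (Ideal.span (thetaBelow δ C (DVar.act φ ⟨u.op ⊔ v.op, u.var⟩))) (HSet C) := by
  induction φ using theta_induction with
  | h0 =>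
    rw [zero_add, zero_add, DVar.act_zero]
    exact hC f hf g hg u v hu hv huv
  | hs φ i ih =>
    set w : DVar m n := ⟨u.op ⊔ v.op, u.var⟩ with hw
    have hact : (w.act φ).act (Finsupp.single i 1) = w.act (φ + Finsupp.single i 1) := by
      rw [DVar.act_act, add_comm]
    have hlt : w.act φ < w.act (φ + Finsupp.single i 1) := by
      rw [← hact]; exact hr.lt_act (by simp) _
    have hsub : thetaBelow δ C (w.act φ) ⊆ thetaBelow δ C (w.act (φ + Finsupp.single i 1)) :=
      fun p ⟨hp, x, hx, hxw⟩ => ⟨hp, x, hx, hxw.trans hlt⟩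
    have hmem : ∀ (h : MvPolynomial (DVar m n) k) (x : DVar m n), h ∈ C → IsLeader h x →
        x.op ≤ w.op → x.var = w.var →
        thetaOp δ (φ + (w.op - x.op)) h ∈ thetaBelow δ C (w.act (φ + Finsupp.single i 1)) := by
      intro h x hh hx hle hvar
      refine ⟨⟨h, hh, _, rfl⟩, _, hx.thetaOp δ hδ hr _, ?_⟩
      convert hlt using 1
      ext1
      · change φ + (w.op - x.op) + x.op = φ + w.op
        rw [add_assoc, tsub_add_cancel_of_le hle]
      · exact hvar
    have hd := dpDeriv_mem_saturation δ i
      (J' := Ideal.span (thetaBelow δ C (w.act (φ + Finsupp.single i 1))))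
      (Ideal.span_mono hsub) (fun p hp => dpDeriv_mem_span δ i hsub ?_ hp) ih
    · rw [map_sub, dpDeriv_mul, dpDeriv_mul, ← thetaOp_add_single δ hδ,
        ← thetaOp_add_single δ hδ] at hd
      have h1 := le_saturation _ (HSet C) (Ideal.subset_span (hmem f u hf hu le_sup_left rfl))
      have h2 := le_saturation _ (HSet C)
        (Ideal.subset_span (hmem g v hg hv le_sup_right huv.symm))
      rw [add_right_comm φ (Finsupp.single i 1), add_right_comm φ (Finsupp.single i 1)]
      convert Ideal.add_mem _ (Ideal.sub_mem _ hd
        (Ideal.mul_mem_right (dpDeriv δ i (separant g)) _ h1))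
        (Ideal.mul_mem_right (dpDeriv δ i (separant f)) _ h2) using 1
      ring
    · rintro p ⟨hp, x, hx, hxw⟩
      obtain ⟨c, hc, θ, rfl⟩ := hp
      refine Ideal.subset_span ⟨dpDeriv_mem_thetaSet δ hδ ⟨c, hc, θ, rfl⟩ i,
        x.act (Finsupp.single i 1), ?_, ?_⟩
      · rw [← thetaOp_single δ hδ]
        exact hx.thetaOp δ hδ hr _
      · rw [← hact]
        exact hr.act_lt_act _ hxw

/-- Induction on the leader. An element of ΘC and the member of `B` with the same leader differ, up
to separants, by lower elements of ΘC, which are known to lie in the saturation; separants cancel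
there. -/
theorem Coherent.satDiffIdeal_le (hδ : ∀ i j a, δ i (δ j a) = δ j (δ i a)) (hr : IsRanking m n)
    {C B : Set (MvPolynomial (DVar m n) k)} (hC : Coherent δ C)
    (hne : ∀ f ∈ C, f.vars.Nonempty) (hB : IsTriangularSection δ C B) :
    satDiffIdeal δ C ≤ saturation (Ideal.span B) (HSet C) := by
  have hwf := hr.wellFoundedLT
  have hnzd : ∀ h ∈ HSet C, IsNZDMod (saturation (Ideal.span B) (HSet C)) h := fun h hh =>
    isNZDMod_saturation _ (Submonoid.subset_closure hh)
  have key : ∀ v, ∀ p ∈ thetaSet δ C, IsLeader p v →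
      p ∈ saturation (Ideal.span B) (HSet C) := by
    intro v
    induction v using WellFoundedLT.induction with
    | ind v ih =>
      intro p hp hpv
      have hv : v ∈ leaders B := by rw [hB.2.2]; exact ⟨p, hp, hpv⟩
      obtain ⟨b, hb, hbv⟩ := hv
      obtain ⟨f, hf, ψ, rfl⟩ := hp
      obtain ⟨g, hg, ψ', rfl⟩ := hB.1 hb
      obtain ⟨u, hu⟩ := exists_isLeader (hne f hf)
      obtain ⟨u', hu'⟩ := exists_isLeader (hne g hg)
      have e1 := hpv.unique (hu.thetaOp δ hδ hr ψ)
      have e2 := hbv.unique (hu'.thetaOp δ hδ hr ψ')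
      have ho1 : v.op = ψ + u.op := congr_arg DVar.op e1
      have ho2 : v.op = ψ' + u'.op := congr_arg DVar.op e2
      have hv1 : v.var = u.var := (congr_arg DVar.var e1 :)
      have hv2 : v.var = u'.var := (congr_arg DVar.var e2 :)
      have hle1 : u.op ≤ v.op := by rw [ho1]; exact le_add_self
      have hle2 : u'.op ≤ v.op := by rw [ho2]; exact le_add_self
      -- This operator takes the least common derivative of the two leaders to `v`.
      have h := hC.thetaOp_mem δ hδ hr hf hg hu hu' (hv1.symm.trans hv2)
        (v.op - (u.op ⊔ u'.op))
      have hφ1 : v.op - (u.op ⊔ u'.op) + (u.op ⊔ u'.op - u.op) = ψ := by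
        rw [tsub_add_tsub_cancel (sup_le hle1 hle2) le_sup_left, ho1, add_tsub_cancel_right]
      have hφ2 : v.op - (u.op ⊔ u'.op) + (u.op ⊔ u'.op - u'.op) = ψ' := by
        rw [tsub_add_tsub_cancel (sup_le hle1 hle2) le_sup_right, ho2, add_tsub_cancel_right]
      have hφ3 : DVar.act (v.op - (u.op ⊔ u'.op)) ⟨u.op ⊔ u'.op, u.var⟩ = v := by
        ext1
        · exact tsub_add_cancel_of_le (sup_le hle1 hle2)
        · exact hv1.symm
      rw [hφ1, hφ2, hφ3] at h
      have hle : thetaBelow δ C v ⊆ saturation (Ideal.span B) (HSet C) := by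
        rintro p ⟨hp, x, hx, hxv⟩
        exact ih x hxv p hp hx
      have h2 := saturation_le (Ideal.span_le.2 hle) hnzd h
      refine hnzd (separant g) (Or.inr ⟨g, hg, rfl⟩) _ ?_
      have h3 := Ideal.add_mem _ h2 (Ideal.mul_mem_left _ (separant f)
        (le_saturation _ (HSet C) (Ideal.subset_span hb)))
      rwa [sub_add_cancel] at h3
  refine saturation_le (Ideal.span_le.2 fun p hp => ?_) hnzd
  obtain ⟨f, hf, θ, rfl⟩ := id hp
  obtain ⟨u, hu⟩ := exists_isLeader (hne f hf)
  exact key _ _ hp (hu.thetaOp δ hδ hr θ)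

omit [CharZero k] in
theorem exists_isTriangularSection (C : Set (MvPolynomial (DVar m n) k)) :
    ∃ B, IsTriangularSection δ C B := by
  have h : ∀ u : leaders (thetaSet δ C), ∃ f ∈ thetaSet δ C, IsLeader f u := fun u => u.2
  choose b hb hbu using h
  refine ⟨Set.range b, ?_, ⟨?_, ?_⟩, ?_⟩
  · rintro _ ⟨u, rfl⟩; exact hb u
  · rintro _ ⟨u, rfl⟩; exact (hbu u).nonempty
  · rintro _ ⟨u, rfl⟩ _ ⟨v, rfl⟩ w hu hv
    have : u = v := Subtype.ext (((hbu u).unique hu).trans (hv.unique (hbu v)))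
    rw [this]
  · ext u
    constructor
    · rintro ⟨_, ⟨v, rfl⟩, hu⟩
      exact ⟨_, hb v, hu⟩
    · intro hu
      exact ⟨_, ⟨⟨u, hu⟩, rfl⟩, hbu ⟨u, hu⟩⟩

/-- An element of `[C] : H_C^∞` whose leader is not a derivative of a leader of `C` has its
initial in the ideal. -/
theorem Coherent.initial_mem (hδ : ∀ i j a, δ i (δ j a) = δ j (δ i a)) (hr : IsRanking m n)
    {C : Set (MvPolynomial (DVar m n) k)} (hC : Coherent δ C)
    (hne : ∀ f ∈ C, f.vars.Nonempty) {f : MvPolynomial (DVar m n) k} {u : DVar m n}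
    (hf : f ∈ satDiffIdeal δ C) (hu : IsLeader f u) (huC : u ∉ thetaVars (leaders C)) :
    initial f ∈ satDiffIdeal δ C := by
  have hwf := hr.wellFoundedLT
  obtain ⟨B, hB⟩ := exists_isTriangularSection δ C
  have hHB : ∀ b ∈ B, separant b ∈ HSet C := fun b hb =>
    HSet_thetaSet_subset δ hδ hr hne (Or.inr ⟨b, hB.1 hb, rfl⟩)
  have huB : u ∉ leaders B := by rwa [hB.2.2, leaders_thetaSet δ hδ hr hne]
  refine saturation_le ((Ideal.span_le.2 ?_)) (fun h hh => isNZDMod_saturation _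
    (Submonoid.subset_closure hh)) (initial_mem_saturation hB.2.1 hHB huB
      (hC.satDiffIdeal_le δ hδ hr hne hB hf) hu)
  exact hB.1.trans (thetaSet_subset_satDiffIdeal δ C)

end Coherent
end DiffAlg

namespace DiffAlg
open MvPolynomial

/-! ### Differential reduction by algebraic reduction -/

section DifferentialReduction

variable {k : Type*} [Field k] {m n : ℕ} (δ : Fin m → Derivation ℤ k k)
  [LinearOrder (DVar m n)]

/-- The derivatives that are not proper derivatives of elements of `L`, when no element of `L` is a
proper derivative of another one. -/
def reducedVars (L : Set (DVar m n)) : Set (DVar m n) := (thetaVars L \ L)ᶜ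

omit [LinearOrder (DVar m n)] in
theorem subset_thetaVars (L : Set (DVar m n)) : L ⊆ thetaVars L := fun u hu =>
  ⟨u, hu, 0, (DVar.act_zero u).symm⟩

omit [LinearOrder (DVar m n)] in
theorem reducedVars_subset {L L' : Set (DVar m n)} (h : L ⊆ L') :
    reducedVars L ⊆ prolongationVars L L' := by
  intro v hv
  by_cases hvL : v ∈ thetaVars L
  · exact Or.inl (h (by_contra fun h' => hv ⟨hvL, h'⟩))
  · exact Or.inr hvL

theorem Autoreduced.algAutoreduced {C : Set (MvPolynomial (DVar m n) k)} (hC : Autoreduced C) :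
    AlgAutoreduced C := ⟨hC.1, fun f hf g hg hne => (hC.2 f hf g hg hne).2⟩

theorem Autoreduced.partiallyReduced (hr : IsRanking m n) {C : Set (MvPolynomial (DVar m n) k)}
    (hC : Autoreduced C) {f g : MvPolynomial (DVar m n) k} (hf : f ∈ C) (hg : g ∈ C) :
    PartiallyReduced f g := by
  by_cases hne : f = g
  · subst hne
    intro u hu θ hθ
    exact hu.notMem_vars_of_lt (hr.lt_act hθ u)
  · exact (hC.2 f hf g hg hne).1

theorem Autoreduced.act_notMem_leaders (hr : IsRanking m n) {C : Set (MvPolynomial (DVar m n) k)}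
    (hC : Autoreduced C) {u : DVar m n} (hu : u ∈ leaders C) {θ : Fin m →₀ ℕ} (hθ : θ ≠ 0) :
    u.act θ ∉ leaders C := by
  rintro ⟨g, hg, hgu⟩
  obtain ⟨f, hf, hfu⟩ := hu
  exact hC.partiallyReduced hr hg hf u hfu θ hθ hgu.1

theorem forall_partiallyReduced_iff (hr : IsRanking m n) {C : Set (MvPolynomial (DVar m n) k)}
    (hC : Autoreduced C) {p : MvPolynomial (DVar m n) k} :
    (∀ c ∈ C, PartiallyReduced p c) ↔ p ∈ supported k (reducedVars (leaders C)) := by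
  rw [MvPolynomial.mem_supported]
  constructor
  · rintro h v hv ⟨⟨u, ⟨c, hc, hu⟩, θ, rfl⟩, hvC⟩
    refine h c hc u hu θ ?_ hv
    rintro rfl
    rw [DVar.act_zero] at hvC
    exact hvC ⟨c, hc, hu⟩
  · intro h c hc u hu θ hθ hv
    exact h hv ⟨⟨u, ⟨c, hc, hu⟩, θ, rfl⟩, hC.act_notMem_leaders hr ⟨c, hc, hu⟩ hθ⟩

theorem Autoreduced.mem_supported (hr : IsRanking m n) {C : Set (MvPolynomial (DVar m n) k)}
    (hC : Autoreduced C) {f : MvPolynomial (DVar m n) k} (hf : f ∈ C) :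
    f ∈ supported k (reducedVars (leaders C)) :=
  (forall_partiallyReduced_iff hr hC).1 fun _ hc => hC.partiallyReduced hr hf hc

theorem isDiffCharSet_iff (hr : IsRanking m n) {I : Ideal (MvPolynomial (DVar m n) k)}
    (h1 : 1 ∉ I) {A : Set (MvPolynomial (DVar m n) k)} : IsDiffCharSet I A ↔
      Autoreduced A ∧ A ⊆ I ∧ ∀ p ∈ I, p ∈ supported k (reducedVars (leaders A)) →
        (∀ a ∈ A, AlgReduced p a) → p = 0 := by
  constructor
  · rintro ⟨hA, hAI, hmin⟩
    refine ⟨hA, hAI, fun p hp hps hred => ?_⟩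
    rw [← forall_partiallyReduced_iff hr hA] at hps
    by_contra hp0
    by_cases hv : p.vars.Nonempty
    · obtain ⟨u, hu⟩ := exists_isLeader hv
      have hins := algAutoreduced_insert hA.algAutoreduced hu hred
      refine hmin _ ⟨hins.1, fun f hf g hg hne => ⟨?_, hins.2 f hf g hg hne⟩⟩ ?_
        (lowerRank_of_reduced hu hred)
      · rcases hf with hf | rfl <;> rcases hg with hg | rfl
        · exact hA.partiallyReduced hr hf.1 hg.1
        · obtain ⟨-, w, hw, hlt⟩ := hf
          intro v hv θ hθ
          obtain rfl := hv.unique hu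
          exact hw.notMem_vars_of_lt (hlt.trans (hr.lt_act hθ v))
        · exact hps g hg.1
        · exact absurd rfl hne
      · rintro f (hf | rfl)
        exacts [hAI hf.1, hp]
    · exact h1 (one_mem_of_vars_empty hp hp0 hv)
  · rintro ⟨hA, hAI, hz⟩
    refine ⟨hA, hAI, fun B hB hBI hlow => ?_⟩
    obtain ⟨p, hp, u, hu, h⟩ := exists_reduced_of_lowerRank hB.algAutoreduced hlow
    refine hu.ne_zero (hz p (hBI hp) ?_ fun a ha => (h a ha).1)
    rw [← forall_partiallyReduced_iff hr hA]
    intro a ha v hv θ hθ hmem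
    -- A proper derivative of `v` occurs in `p`, so `v` is below `u` and is the leader of another
    -- element of `B`; this contradicts the autoreducedness of `B`.
    obtain ⟨b, hb, hne, hbv⟩ := (h a ha).2 v hv ((hr.lt_act hθ v).trans_le (hu.2 _ hmem))
    exact (hB.2 p hp b hb hne).1 v hbv θ hθ hmem

variable {δ}

theorem IsTriangularSection.subset_satDiffIdeal {C B : Set (MvPolynomial (DVar m n) k)}
    (hB : IsTriangularSection δ C B) : B ⊆ satDiffIdeal δ C :=
  hB.1.trans (thetaSet_subset_satDiffIdeal δ C)

variable [CharZero k] (hδ : ∀ i j a, δ i (δ j a) = δ j (δ i a)) (hr : IsRanking m n)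
include hδ hr

theorem IsTriangularSection.HSet_subset {C B : Set (MvPolynomial (DVar m n) k)}
    (hB : IsTriangularSection δ C B) (hne : ∀ f ∈ C, f.vars.Nonempty) : HSet B ⊆ HSet C :=
  (Set.union_subset_union (Set.image_mono hB.1) (Set.image_mono hB.1)).trans
    (HSet_thetaSet_subset δ hδ hr hne)

theorem IsTriangularSection.isNZDMod {C B : Set (MvPolynomial (DVar m n) k)}
    (hB : IsTriangularSection δ C B) (hne : ∀ f ∈ C, f.vars.Nonempty)
    {h : MvPolynomial (DVar m n) k} (hh : h ∈ HSet B) : IsNZDMod (satDiffIdeal δ C) h :=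
  isNZDMod_saturation _ (Submonoid.subset_closure (hB.HSet_subset hδ hr hne hh))

theorem IsTriangularSection.leaders_eq {C B : Set (MvPolynomial (DVar m n) k)}
    (hB : IsTriangularSection δ C B) (hne : ∀ f ∈ C, f.vars.Nonempty) :
    leaders B = thetaVars (leaders C) := by
  rw [hB.2.2, leaders_thetaSet δ hδ hr hne]

theorem IsTriangularSection.mem_or {C B : Set (MvPolynomial (DVar m n) k)}
    (hB : IsTriangularSection δ C B) (hC : Autoreduced C) {b : MvPolynomial (DVar m n) k}
    (hb : b ∈ B) {v : DVar m n} (hv : IsLeader b v) :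
    (b ∈ C ∧ v ∈ leaders C) ∨ (v ∈ thetaVars (leaders C) \ leaders C ∧ b.degreeOf v = 1) := by
  obtain ⟨c, hc, θ, rfl⟩ := hB.1 hb
  obtain ⟨u, hu⟩ := exists_isLeader (hC.1 c hc)
  by_cases hθ : θ = 0
  · subst hθ
    rw [thetaOp_zero] at hv ⊢
    exact Or.inl ⟨hc, c, hc, hv⟩
  · obtain ⟨h1, h2, -⟩ := isLeader_thetaOp δ hδ hr hu hθ
    obtain rfl := hv.unique h1
    exact Or.inr ⟨⟨⟨u, ⟨c, hc, hu⟩, θ, rfl⟩, hC.act_notMem_leaders hr ⟨c, hc, hu⟩ hθ⟩, h2⟩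

/-- No leader of `C` is a proper derivative of a leader of `C`, so the only element of ΘC with the
leader of c is c itself. -/
theorem IsTriangularSection.subset {C B : Set (MvPolynomial (DVar m n) k)}
    (hB : IsTriangularSection δ C B) (hC : Autoreduced C) : C ⊆ B := by
  intro c hc
  obtain ⟨u, hu⟩ := exists_isLeader (hC.1 c hc)
  have huB : u ∈ leaders B := by
    rw [hB.leaders_eq hδ hr hC.1]
    exact subset_thetaVars _ ⟨c, hc, hu⟩
  obtain ⟨b, hb, hbu⟩ := huB
  rcases hB.mem_or hδ hr hC hb hbu with h | h
  · rwa [hC.algAutoreduced.triangular.2 c hc b h.1 u hu hbu]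
  · exact absurd ⟨c, hc, hu⟩ h.1.2

/-- Proper derivatives are linear in their leaders, so being algebraically reduced with respect to
them means not containing those variables. Algebraic reduction by `B` is thus differential reduction
by `C`. -/
theorem IsTriangularSection.reduced {C B : Set (MvPolynomial (DVar m n) k)}
    (hB : IsTriangularSection δ C B) (hC : Autoreduced C) {p : MvPolynomial (DVar m n) k}
    (hp : ∀ b ∈ B, AlgReduced p b) : p ∈ supported k (reducedVars (leaders C)) ∧
      ∀ c ∈ C, AlgReduced p c := by
  refine ⟨MvPolynomial.mem_supported.2 fun v hv hvC => ?_,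
    fun c hc => hp c (hB.subset hδ hr hC hc)⟩
  have hvB : v ∈ leaders B := by rw [hB.leaders_eq hδ hr hC.1]; exact hvC.1
  obtain ⟨b, hb, hbv⟩ := hvB
  rcases hB.mem_or hδ hr hC hb hbv with h | h
  · exact hvC.2 h.2
  · have := hp b hb v hbv
    rw [h.2] at this
    exact mem_vars_iff_degreeOf_ne_zero.1 hv (by omega)

theorem exists_mul_sub_mem {C : Set (MvPolynomial (DVar m n) k)} (hC : Autoreduced C)
    (p : MvPolynomial (DVar m n) k) : ∃ s ∈ Submonoid.closure (HSet C),
      ∃ g ∈ supported k (reducedVars (leaders C)), (∀ c ∈ C, AlgReduced g c) ∧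
        s * p - g ∈ diffSpan δ C := by
  have hwf := hr.wellFoundedLT
  obtain ⟨B, hB⟩ := exists_isTriangularSection δ C
  obtain ⟨g, hg, hred⟩ := exists_isAlgRem hB.2.1.2 p
  obtain ⟨s, hs, hsp⟩ := algRem_exists_mul hg
  obtain ⟨h1, h2⟩ := hB.reduced hδ hr hC hred
  exact ⟨s, Submonoid.closure_mono (hB.HSet_subset hδ hr hC.1) hs, g, h1, h2,
    Ideal.span_mono hB.1 hsp⟩

theorem exists_mul_sub_mem_satDiffIdeal {C : Set (MvPolynomial (DVar m n) k)}
    (hC : Autoreduced C) (p : MvPolynomial (DVar m n) k) : ∃ s, IsNZDMod (satDiffIdeal δ C) s ∧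
      ∃ g ∈ supported k (reducedVars (leaders C)), s * p - g ∈ satDiffIdeal δ C := by
  obtain ⟨s, hs, g, hg, -, h⟩ := exists_mul_sub_mem hδ hr hC p
  exact ⟨s, isNZDMod_saturation _ hs, g, hg, le_saturation _ _ h⟩

/-- A nonzerodivisor modulo `I ∩ k[Z]` is one modulo `I`. -/
theorem isNZDMod_of_supported {C : Set (MvPolynomial (DVar m n) k)} (hC : Autoreduced C)
    {h : MvPolynomial (DVar m n) k}
    (hh : ∀ p ∈ supported k (reducedVars (leaders C)), h * p ∈ satDiffIdeal δ C →
      p ∈ satDiffIdeal δ C) : IsNZDMod (satDiffIdeal δ C) h := by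
  intro p hp
  obtain ⟨s, hs, g, hg, hsg⟩ := exists_mul_sub_mem_satDiffIdeal hδ hr hC p
  have h1 : g ∈ satDiffIdeal δ C := by
    refine hh g hg ?_
    have : h * g = s * (h * p) - h * (s * p - g) := by ring
    rw [this]
    exact Ideal.sub_mem _ (Ideal.mul_mem_left _ _ hp) (Ideal.mul_mem_left _ _ hsg)
  refine hs p ?_
  have := Ideal.add_mem _ hsg h1
  rwa [sub_add_cancel] at this

/-- Differential counterpart of one direction of `isAlgCharacterizing_iff`, by the same argument. -/
theorem isDiffCharacterizing_of {I : Ideal (MvPolynomial (DVar m n) k)} (h1 : 1 ∉ I)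
    (hI : ∀ f ∈ I, ∀ θ, thetaOp δ θ f ∈ I) {A : Set (MvPolynomial (DVar m n) k)}
    (hA : Autoreduced A) (hAI : A ⊆ I)
    (hz : ∀ p ∈ I, p ∈ supported k (reducedVars (leaders A)) →
        (∀ a ∈ A, AlgReduced p a) → p = 0)
    (hn : ∀ h ∈ HSet A, IsNZDMod I h) : IsDiffCharacterizing δ I A := by
  have hle : diffSpan δ A ≤ I := Ideal.span_le.2 <| by
    rintro _ ⟨f, hf, θ, rfl⟩
    exact hI f (hAI hf) θ
  refine ⟨(isDiffCharSet_iff hr h1).2 ⟨hA, hAI, hz⟩, le_antisymm (fun p hp => ?_)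
    (saturation_le hle hn)⟩
  obtain ⟨s, hs, g, hg, hred, hsg⟩ := exists_mul_sub_mem hδ hr hA p
  have hgI : g ∈ I := (I.sub_mem_iff_right (I.mul_mem_left s hp)).1 (hle hsg)
  rw [hz g hgI hg hred, sub_zero] at hsg
  exact ⟨s, hs, hsg⟩

/-- If `C` characterizes `I`, the leader of an element of `I` whose initial is a nonzerodivisor
modulo `I` is a derivative of a leader of `C`. -/
theorem leader_mem_thetaVars {C : Set (MvPolynomial (DVar m n) k)}
    (hC : IsDiffCharSet (satDiffIdeal δ C) C) (h1 : 1 ∉ satDiffIdeal δ C)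
    {a : MvPolynomial (DVar m n) k} (ha : a ∈ satDiffIdeal δ C) {u : DVar m n}
    (hu : IsLeader a u) (hi : IsNZDMod (satDiffIdeal δ C) (initial a)) :
    u ∈ thetaVars (leaders C) := by
  have hwf := hr.wellFoundedLT
  obtain ⟨hCa, -, hz⟩ := (isDiffCharSet_iff hr h1).1 hC
  by_contra huC
  obtain ⟨B, hB⟩ := exists_isTriangularSection δ C
  obtain ⟨g, hg, hred⟩ := exists_isAlgRem hB.2.1.2 a
  rw [hu.initial_eq] at hi
  rw [← hB.leaders_eq hδ hr hCa.1] at huC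
  -- With `u` not a leader of `B`, reduction keeps the positive degree in `u`; but the remainder is
  -- a reduced element of the ideal, hence 0.
  have h := algRem_isNZDMod h1 hB.subset_satDiffIdeal
    (fun b hb => hB.isNZDMod hδ hr hCa.1 (Or.inl ⟨b, hb, rfl⟩))
    (fun b hb hbu => absurd (⟨b, hb, hbu⟩ : u ∈ leaders B) huC)
    hg hu.mem_supported rfl hi
  obtain ⟨h2, h3⟩ := hB.reduced hδ hr hCa hred
  have := hz g (algRem_mem hB.subset_satDiffIdeal hg ha) h2 h3
  have hd := h.2.1
  rw [this, degreeOf_zero] at hd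
  exact hu.degreeOf_pos.ne hd

/-- The pseudo-remainder of an element of a triangular section `B` of `Θ C` with respect to the
other elements of `B`. -/
theorem IsTriangularSection.algRem_spec {C B : Set (MvPolynomial (DVar m n) k)}
    (hB : IsTriangularSection δ C B) (hC : Autoreduced C) (h1 : 1 ∉ satDiffIdeal δ C)
    {f g : MvPolynomial (DVar m n) k} (hf : f ∈ B) (hg : IsAlgRem (B \ {f}) f g) {v : DVar m n}
    (hv : IsLeader f v) : g ∈ satDiffIdeal δ C ∧ IsLeader g v ∧ g.degreeOf v = f.degreeOf v ∧
      g ∈ supported k (insert v (reducedVars (leaders C))) ∧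
      IsNZDMod (satDiffIdeal δ C) (initial g) ∧ IsNZDMod (satDiffIdeal δ C) (separant g) := by
  have hBf : B \ {f} ⊆ satDiffIdeal δ C := Set.sdiff_subset.trans hB.subset_satDiffIdeal
  have hif := hB.isNZDMod hδ hr hC.1 (Or.inl ⟨f, hf, rfl⟩)
  rw [hv.initial_eq] at hif
  obtain ⟨hs, hd, hi⟩ := algRem_isNZDMod h1 hBf
    (fun b hb => hB.isNZDMod hδ hr hC.1 (Or.inl ⟨b, hb.1, rfl⟩))
    (fun b hb hbv => absurd (hB.2.1.2 b hb.1 f hf v hbv hv) hb.2) hg.1 hv.mem_supported rfl hif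
  have hgv : IsLeader g v := isLeader_of_mem_supported hs (hd.trans_ne hv.degreeOf_pos.ne')
  rw [← hd, ← hgv.initial_eq] at hi
  refine ⟨algRem_mem hBf hg.1 (hB.subset_satDiffIdeal hf), hgv, hd, ?_, hi, ?_⟩
  · rw [MvPolynomial.mem_supported]
    intro w hw
    by_contra hwn
    rw [Set.mem_insert_iff, not_or] at hwn
    have hwC : w ∈ thetaVars (leaders C) \ leaders C := not_not.1 hwn.2
    have hwB : w ∈ leaders B := by rw [hB.leaders_eq hδ hr hC.1]; exact hwC.1
    obtain ⟨b, hb, hbw⟩ := hwB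
    have hbf : b ≠ f := by
      rintro rfl
      exact hwn.1 (hbw.unique hv)
    rcases hB.mem_or hδ hr hC hb hbw with h | h
    · exact hwC.2 h.2
    · have := hg.2 b ⟨hb, hbf⟩ w hbw
      rw [h.2] at this
      exact mem_vars_iff_degreeOf_ne_zero.1 hw (by omega)
  -- An element of `C` is already reduced, so `g = f`; otherwise `g` is linear in `v` and its
  -- separant is its initial.
  · rcases hB.mem_or hδ hr hC hf hv with h | h
    · have hgf : g = f := hg.eq_self fun b hb w hw => by
        rcases hB.mem_or hδ hr hC hb.1 hw with hbC | hbC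
        · exact (hC.2 f h.1 b hbC.1 (Ne.symm hb.2)).2 w hw
        · rw [hbC.2, degreeOf_eq_zero_of_notMem]
          · exact one_pos
          · exact fun hwf => MvPolynomial.mem_supported.1 (hC.mem_supported hr h.1) hwf hbC.1
      rw [hgf]
      exact hB.isNZDMod hδ hr hC.1 (Or.inr ⟨f, hf, rfl⟩)
    · have hd1 : g.degreeOf v = 1 := hd.trans h.2
      rwa [hgv.separant_eq, pderiv_of_degreeOf_eq_one hd1, ← hd1, ← hgv.initial_eq]

end DifferentialReduction
end DiffAlg

namespace DiffAlg
open MvPolynomial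

/-! ### Prolongation ideals -/

section Prolongation

theorem AlgAutoreduced.algReduced_initial {σ : Type*} [LinearOrder σ] {k : Type*} [Field k]
    {A : Set (MvPolynomial σ k)} (hA : AlgAutoreduced A) {a b : MvPolynomial σ k} (ha : a ∈ A)
    (hb : b ∈ A) : AlgReduced (initial a) b := by
  intro v hv
  by_cases hab : a = b
  · subst hab
    rw [degreeOf_eq_zero_of_notMem hv.notMem_vars_initial]
    exact hv.degreeOf_pos
  · obtain ⟨u, hu⟩ := exists_isLeader (hA.1 a ha)
    rw [hu.initial_eq]
    exact (degreeOf_coeffAt_le _ _ _ _).trans_lt (hA.2 a ha b hb hab v hv)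

theorem IsLeader.initial_mem_supported_of {σ : Type*} [LinearOrder σ] {k : Type*} [Field k]
    {f : MvPolynomial σ k} {u : σ} (hu : IsLeader f u) {S : Set σ} (hf : f ∈ supported k S) :
    initial f ∈ supported k S :=
  supported_mono (fun _ hv => MvPolynomial.mem_supported.1 hf hv.1) hu.initial_mem_supported

theorem mem_supported_of_mul_eq {σ : Type*} {k : Type*} [Field k] {f g h : MvPolynomial σ k}
    {S : Set σ} (hf : f ∈ supported k S) (hf0 : f ≠ 0) (hfg : f = g * h) : g ∈ supported k S := by
  have hg0 : g ≠ 0 := by rintro rfl; exact hf0 (by rw [hfg, zero_mul])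
  have hh0 : h ≠ 0 := by rintro rfl; exact hf0 (by rw [hfg, mul_zero])
  rw [mem_supported] at hf ⊢
  refine subset_trans (fun v hv => ?_) hf
  have := mem_vars_iff_degreeOf_ne_zero.1 hv
  refine mem_vars_iff_degreeOf_ne_zero.2 ?_
  rw [hfg, degreeOf_mul_eq hg0 hh0]
  omega

variable {k : Type*} [Field k] {m n : ℕ} {δ : Fin m → Derivation ℤ k k}

/-- Passing from an element of `L` down to `L₁` and on to `L` exhibits it as a derivative of a
member of `L`, so both operators are trivial. -/
theorem subset_of_subset_thetaVars {L L₁ : Set (DVar m n)} (h : L ⊆ thetaVars L₁)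
    (h₁ : L₁ ⊆ thetaVars L) (hL : ∀ u ∈ L, ∀ θ, θ ≠ 0 → u.act θ ∉ L) : L ⊆ L₁ := by
  intro u hu
  obtain ⟨w, hw, θ, rfl⟩ := h hu
  obtain ⟨u', hu', ψ, rfl⟩ := h₁ hw
  rw [DVar.act_act] at hu
  have h0 : θ + ψ = 0 := by_contra fun h => hL u' hu' _ h hu
  obtain ⟨rfl, -⟩ := add_eq_zero.1 h0
  rwa [DVar.act_zero]

variable [LinearOrder (DVar m n)]

theorem restrictIdeal_isPrime_of [CharZero k] (hδ : ∀ i j a, δ i (δ j a) = δ j (δ i a))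
    (hr : IsRanking m n) {C : Set (MvPolynomial (DVar m n) k)} (hC : Autoreduced C)
    (h1 : 1 ∉ satDiffIdeal δ C) {Z : Set (DVar m n)} (hZ : reducedVars (leaders C) ⊆ Z)
    (h : (restrictIdeal (satDiffIdeal δ C) Z).IsPrime) : (satDiffIdeal δ C).IsPrime := by
  refine ⟨fun htop => h1 (htop ▸ Submodule.mem_top), fun {a b} hab => ?_⟩
  obtain ⟨s, hs, f, hf, hsf⟩ := exists_mul_sub_mem_satDiffIdeal hδ hr hC a
  obtain ⟨t, ht, g, hg, htg⟩ := exists_mul_sub_mem_satDiffIdeal hδ hr hC b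
  obtain ⟨f, rfl⟩ := exists_rename_val_eq (supported_mono hZ hf)
  obtain ⟨g, rfl⟩ := exists_rename_val_eq (supported_mono hZ hg)
  have hfg : f * g ∈ restrictIdeal (satDiffIdeal δ C) Z := by
    change rename Subtype.val (f * g) ∈ satDiffIdeal δ C
    rw [map_mul]
    have : rename Subtype.val f * rename Subtype.val g = s * t * (a * b) -
        t * b * (s * a - rename Subtype.val f) -
        rename Subtype.val f * (t * b - rename Subtype.val g) := by ring
    rw [this]
    exact Ideal.sub_mem _ (Ideal.sub_mem _ (Ideal.mul_mem_left _ _ hab)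
      (Ideal.mul_mem_left _ _ hsf)) (Ideal.mul_mem_left _ _ htg)
  rcases h.mem_or_mem hfg with h | h
  · refine Or.inl (hs a ?_)
    have := Ideal.add_mem _ hsf h
    rwa [sub_add_cancel] at this
  · refine Or.inr (ht b ?_)
    have := Ideal.add_mem _ htg h
    rwa [sub_add_cancel] at this

variable [CharZero k] (hδ : ∀ i j a, δ i (δ j a) = δ j (δ i a)) (hr : IsRanking m n)
include hδ hr

/-- The remainders keep leaders and degrees and have nonzerodivisor initials and separants. A
polynomial in k[Z] reduced with respect to them is reduced with respect to all of `B`, as leaders of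
`B` outside `L'` are not in Z; so in the ideal it is 0. -/
theorem IsTriangularSection.exists_isAlgCharacterizing {C B : Set (MvPolynomial (DVar m n) k)}
    (hB : IsTriangularSection δ C B) (hC : IsDiffCharSet (satDiffIdeal δ C) C)
    (h1 : 1 ∉ satDiffIdeal δ C) {L' : Set (DVar m n)} (hL : leaders C ⊆ L')
    {algrem : MvPolynomial (DVar m n) k → MvPolynomial (DVar m n) k}
    (hrem : ∀ f ∈ B, IsAlgRem (B \ {f}) f (algrem f)) :
    ∃ A : Set (MvPolynomial (prolongationVars (leaders C) L') k),
      liftSet A = {g | ∃ f ∈ B, (∃ u ∈ L', IsLeader f u) ∧ g = algrem f} ∧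
      IsAlgCharacterizing (restrictIdeal (satDiffIdeal δ C)
        (prolongationVars (leaders C) L')) A := by
  have hwf := hr.wellFoundedLT
  obtain ⟨hCa, -, hz⟩ := (isDiffCharSet_iff hr h1).1 hC
  set Z := prolongationVars (leaders C) L' with hZ
  set A' := {g | ∃ f ∈ B, (∃ u ∈ L', IsLeader f u) ∧ g = algrem f} with hA'
  have spec := fun {f} (hf : f ∈ B) {v} (hv : IsLeader f v) =>
    hB.algRem_spec hδ hr hCa h1 hf (hrem f hf) hv
  have hlift : liftSet (rename (Subtype.val : Z → DVar m n) ⁻¹' A') = A' := by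
    refine Set.image_preimage_eq_of_subset ?_
    rintro _ ⟨f, hf, ⟨u, hu, hfu⟩, rfl⟩
    refine exists_rename_val_eq (supported_mono ?_ (spec hf hfu).2.2.2.1)
    exact Set.insert_subset (Or.inl hu) (reducedVars_subset hL)
  refine ⟨_, hlift, (isAlgCharacterizing_restrictIdeal_iff h1).2 ?_⟩
  rw [hlift]
  refine ⟨⟨?_, ?_⟩, ?_, ?_, ?_⟩
  · rintro _ ⟨f, hf, ⟨u, hu, hfu⟩, rfl⟩
    exact (spec hf hfu).2.1.nonempty
  · rintro _ ⟨f, hf, ⟨u, hu, hfu⟩, rfl⟩ _ ⟨g, hg, ⟨v, hv, hgv⟩, rfl⟩ hne w hw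
    obtain rfl := hw.unique (spec hg hgv).2.1
    rw [(spec hg hgv).2.2.1]
    have hgf : g ≠ f := by rintro rfl; exact hne rfl
    exact (hrem f hf).2 g ⟨hg, hgf⟩ w hgv
  · rintro _ ⟨f, hf, ⟨u, hu, hfu⟩, rfl⟩
    exact (spec hf hfu).1
  · intro p hp hpZ hred
    have hred' : ∀ b ∈ B, AlgReduced p b := by
      intro b hb v hv
      by_cases hvL : v ∈ L'
      · have h := spec hb hv
        rw [← h.2.2.1]
        exact hred _ ⟨b, hb, ⟨v, hvL, hv⟩, rfl⟩ v h.2.1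
      · rw [degreeOf_eq_zero_of_notMem]
        · exact hv.degreeOf_pos
        · intro hvp
          rcases MvPolynomial.mem_supported.1 hpZ hvp with h | h
          · exact hvL h
          · refine h ?_
            rw [← hB.leaders_eq hδ hr hCa.1]
            exact ⟨b, hb, hv⟩
    obtain ⟨h2, h3⟩ := hB.reduced hδ hr hCa hred'
    exact hz p hp h2 h3
  · rintro _ (⟨_, ⟨f, hf, ⟨u, hu, hfu⟩, rfl⟩, rfl⟩ | ⟨_, ⟨f, hf, ⟨u, hu, hfu⟩, rfl⟩, rfl⟩) p - hp
    · exact (spec hf hfu).2.2.2.2.1 p hp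
    · exact (spec hf hfu).2.2.2.2.2 p hp

omit hδ [CharZero k] in
theorem weakDTriangular_of_leaders {C A : Set (MvPolynomial (DVar m n) k)}
    (hC : Autoreduced C) (hA : Triangular A) :
    WeakDTriangular {a ∈ A | ∃ u ∈ leaders C, IsLeader a u} := by
  refine ⟨fun f hf => hA.1 f hf.1, ?_⟩
  rintro f ⟨hf, x, hx, hfx⟩ g ⟨hg, y, hy, hgy⟩ hne u v hu hv θ rfl
  obtain rfl := hu.unique hfx
  obtain rfl := hv.unique hgy
  by_cases hθ : θ = 0
  · subst hθ
    rw [DVar.act_zero] at hu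
    exact hne (hA.2 f hf g hg v hu hv)
  · exact hC.act_notMem_leaders hr hy hθ hx

-- Compare `T` with the candidate at the lowest rank where they differ. If that rank occurs in `T`,
-- its leader is a proper derivative of some u in ld C, whose lower rank also occurs in `T`, against
-- weak d-triangularity. If it occurs in the candidate, `T` is not minimal.
omit hδ [CharZero k] in
theorem IsMinWeakDTriangular.eq {C A T : Set (MvPolynomial (DVar m n) k)}
    (hT : IsMinWeakDTriangular A T) (hC : Autoreduced C) (hA : Triangular A)
    (hlead : ∀ a ∈ A, ∀ u, IsLeader a u → u ∈ thetaVars (leaders C))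
    (hCA : leaders C ⊆ leaders A) : T = {a ∈ A | ∃ u ∈ leaders C, IsLeader a u} := by
  have hwf := hr.wellFoundedLT
  set T₀ := {a ∈ A | ∃ u ∈ leaders C, IsLeader a u} with hT₀
  obtain ⟨hTA, hTw, hmin⟩ := hT
  have hsub : ∀ S S' : Set (MvPolynomial (DVar m n) k), S ⊆ A → S' ⊆ A →
      (∀ r ∈ rankSet S, r ∈ rankSet S') → S ⊆ S' := by
    intro S S' hS hS' h f hf
    obtain ⟨u, hu⟩ := exists_isLeader (hA.1 f (hS hf))
    obtain ⟨g, hg, v, hv, hr⟩ := h _ ⟨f, hf, u, hu, rfl⟩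
    obtain ⟨rfl, -⟩ := Prod.mk.inj (toLex.injective hr)
    rwa [hA.2 f (hS hf) g (hS' hg) u hu hv]
  have hT₀A : T₀ ⊆ A := fun a ha => ha.1
  by_cases hex : ∃ r, ¬ (r ∈ rankSet T₀ ↔ r ∈ rankSet T)
  · exfalso
    obtain ⟨r, hr', hrmin⟩ := WellFounded.has_min (wellFounded_lt (α := DVar m n ×ₗ ℕ))
      {r | ¬ (r ∈ rankSet T₀ ↔ r ∈ rankSet T)} hex
    have hlow : ∀ s < r, (s ∈ rankSet T₀ ↔ s ∈ rankSet T) := fun s hs =>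
      by_contra fun h => hrmin s h hs
    by_cases hrT : r ∈ rankSet T
    · have hrT₀ : r ∉ rankSet T₀ := fun h => hr' (iff_of_true h hrT)
      obtain ⟨f, hf, v, hv, rfl⟩ := hrT
      obtain ⟨u, hu, θ, rfl⟩ := hlead f (hTA hf) v hv
      have hθ : θ ≠ 0 := by
        rintro rfl
        rw [DVar.act_zero] at hv hrT₀
        exact hrT₀ ⟨f, ⟨hTA hf, u, hu, hv⟩, u, hv, rfl⟩
      have huv := hr.lt_act hθ u
      obtain ⟨a, ha, hau⟩ := hCA hu
      obtain ⟨g, hg, w, hw, h⟩ := (hlow _ (Prod.Lex.toLex_lt_toLex.2 (Or.inl huv))).1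
        ⟨a, ⟨ha, u, hu, hau⟩, u, hau, rfl⟩
      obtain ⟨rfl, -⟩ := Prod.mk.inj (toLex.injective h)
      have hfg : f ≠ g := by
        rintro rfl
        exact huv.ne (hw.unique hv)
      exact hTw.2 f hf g hg hfg _ _ hv hw θ rfl
    · have hrT₀ : r ∈ rankSet T₀ := by_contra fun h => hr' (iff_of_false h hrT)
      exact hmin T₀ hT₀A (weakDTriangular_of_leaders hr hC hA) ⟨r, hrT₀, hrT, hlow⟩
  · push Not at hex
    exact Set.Subset.antisymm (hsub _ _ hTA hT₀A fun r h => (hex r).2 h)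
      (hsub _ _ hT₀A hTA fun r h => (hex r).1 h)

/-- If `A` characterizes the prolongation ideal and its leaders are derivatives of the leaders
of `C`, the elements of `A` with leader in `ld C` characterize the differential ideal. -/
theorem isDiffCharacterizing_of_restrictIdeal {C : Set (MvPolynomial (DVar m n) k)}
    (hC : Autoreduced C) (h1 : 1 ∉ satDiffIdeal δ C) {L' : Set (DVar m n)} (hL : leaders C ⊆ L')
    (hL' : L' ⊆ thetaVars (leaders C)) {A : Set (MvPolynomial (prolongationVars (leaders C) L') k)}
    (hA : IsAlgCharacterizing (restrictIdeal (satDiffIdeal δ C)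
      (prolongationVars (leaders C) L')) A)
    (hlead : ∀ a ∈ liftSet A, ∀ u, IsLeader a u → u ∈ thetaVars (leaders C)) :
    leaders C ⊆ leaders (liftSet A) ∧
    (∀ a ∈ liftSet A, (∃ u ∈ leaders C, IsLeader a u) →
      a ∈ supported k (reducedVars (leaders C))) ∧
    IsDiffCharacterizing δ (satDiffIdeal δ C)
      {a ∈ liftSet A | ∃ u ∈ leaders C, IsLeader a u} := by
  have hwf := hr.wellFoundedLT
  obtain ⟨hAa, hAI, hz, hn⟩ := (isAlgCharacterizing_restrictIdeal_iff h1).1 hA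
  have hn' : ∀ h ∈ HSet (liftSet A), IsNZDMod (satDiffIdeal δ C) h := fun h hh =>
    isNZDMod_of_supported hδ hr hC fun p hp => hn h hh p (supported_mono (reducedVars_subset hL) hp)
  have hAZ : ∀ a ∈ liftSet A, a ∈ supported k (prolongationVars (leaders C) L') := by
    rintro _ ⟨a, -, rfl⟩
    exact rename_val_mem_supported a
  obtain ⟨B, hB⟩ := exists_isTriangularSection δ C
  -- `A` has every `v` in `L'` as a leader, linearly if `v` is a proper derivative. Otherwise,
  -- dividing the remainder `g` built from a triangular section by `A` would keep its degree in `v`,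
  -- while the result must be 0.
  have hex : ∀ v ∈ L', ∃ a ∈ liftSet A, IsLeader a v ∧ (v ∉ leaders C → a.degreeOf v ≤ 1) := by
    intro v hv
    have hvB : v ∈ leaders B := by rw [hB.leaders_eq hδ hr hC.1]; exact hL' hv
    obtain ⟨f, hf, hfv⟩ := hvB
    obtain ⟨g, hg⟩ := exists_isAlgRem (B := B \ {f})
      (fun b hb c hc => hB.2.1.2 b hb.1 c hc.1) f
    obtain ⟨hgI, hgv, hd, hgs, hi, -⟩ := hB.algRem_spec hδ hr hC h1 hf hg hfv
    have hd1 : v ∉ leaders C → g.degreeOf v = 1 := fun h => by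
      rcases hB.mem_or hδ hr hC hf hfv with h' | h'
      · exact absurd h'.2 h
      · rw [hd, h'.2]
    by_contra hno
    obtain ⟨r, hr', hred⟩ := exists_isAlgRem hAa.triangular.2 g
    rw [hgv.initial_eq] at hi
    have h := algRem_isNZDMod h1 hAI (fun b hb => hn' _ (Or.inl ⟨b, hb, rfl⟩))
      (fun b hb hbv => by
        by_contra hlt
        exact hno ⟨b, hb, hbv, fun h => (not_lt.1 hlt).trans (hd1 h).le⟩)
      hr' hgv.mem_supported rfl hi
    have hZ : insert v (reducedVars (leaders C)) ⊆ prolongationVars (leaders C) L' :=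
      Set.insert_subset (Or.inl hv) (reducedVars_subset hL)
    have hgZ : g ∈ supported k (prolongationVars (leaders C) L') := supported_mono hZ hgs
    have hrI : r ∈ satDiffIdeal δ C := algRem_mem hAI hr' hgI
    have hr0 : r = 0 := hz r hrI (algRem_mem_supported hr' hAZ hgZ) hred
    have h2 := h.2.1
    rw [hr0, degreeOf_zero] at h2
    exact hgv.degreeOf_pos.ne h2
  have hCA : leaders C ⊆ leaders (liftSet A) := fun u hu => by
    obtain ⟨a, ha, hau, -⟩ := hex u (hL hu)
    exact ⟨a, ha, hau⟩
  have hsup : ∀ a ∈ liftSet A, (∃ u ∈ leaders C, IsLeader a u) →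
      a ∈ supported k (reducedVars (leaders C)) := by
    rintro a ha ⟨u, hu, hau⟩
    rw [MvPolynomial.mem_supported]
    intro v hv hvC
    rcases MvPolynomial.mem_supported.1 (hAZ a ha) hv with hvL | hvL
    · obtain ⟨b, hb, hbv, hd⟩ := hex v hvL
      -- `b` is linear in the proper derivative `v`, so autoreducedness of `A` removes `v` from `a`.
      have hab : a ≠ b := by
        rintro rfl
        rw [hau.unique hbv] at hu
        exact hvC.2 hu
      have h2 := hAa.2 a ha b hb hab v hbv
      have h3 := hd hvC.2
      exact mem_vars_iff_degreeOf_ne_zero.1 hv (by omega)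
    · exact hvL hvC.1
  have hleadT : leaders {a ∈ liftSet A | ∃ u ∈ leaders C, IsLeader a u} = leaders C := by
    ext u
    constructor
    · rintro ⟨a, ⟨-, v, hv, hav⟩, hau⟩
      rwa [hau.unique hav]
    · intro hu
      obtain ⟨a, ha, hau⟩ := hCA hu
      exact ⟨a, ⟨ha, u, hu, hau⟩, hau⟩
  refine ⟨hCA, hsup, isDiffCharacterizing_of hδ hr h1
    (fun f hf θ => thetaOp_mem_satDiffIdeal δ hδ hf θ) ⟨fun f hf => hAa.1 f hf.1, ?_⟩
    (fun a ha => hAI ha.1) ?_ ?_⟩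
  · rintro f hf g ⟨hg, u, hu, hgu⟩ hne
    refine ⟨?_, hAa.2 f hf.1 g hg hne⟩
    intro v hv θ hθ hmem
    obtain rfl := hv.unique hgu
    exact MvPolynomial.mem_supported.1 (hsup f hf.1 hf.2) hmem
      ⟨⟨v, hu, θ, rfl⟩, hC.act_notMem_leaders hr hu hθ⟩
  · intro p hp hps hred
    rw [hleadT] at hps
    refine hz p hp (supported_mono (reducedVars_subset hL) hps) fun a ha v hv => ?_
    by_cases hvC : v ∈ leaders C
    · exact hred a ⟨ha, v, hvC, hv⟩ v hv
    -- Elements of `A` with leader outside ld C impose no condition: such a leader is a proper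
    -- derivative and is absent from `p`.
    · rw [degreeOf_eq_zero_of_notMem]
      · exact hv.degreeOf_pos
      · exact fun h => MvPolynomial.mem_supported.1 hps h ⟨hlead a ha v hv, hvC⟩
  · rintro h (⟨a, ha, rfl⟩ | ⟨a, ha, rfl⟩)
    · exact hn' _ (Or.inl ⟨a, ha.1, rfl⟩)
    · exact hn' _ (Or.inr ⟨a, ha.1, rfl⟩)

/-- The leaders of a characterizing set of the ideal of a coherent autoreduced set `C` are those
of `C`. -/
theorem Coherent.leaders_eq {C C' : Set (MvPolynomial (DVar m n) k)} (hC : Autoreduced C)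
    (hcoh : Coherent δ C) (h1 : 1 ∉ satDiffIdeal δ C)
    (hC' : IsDiffCharacterizing δ (satDiffIdeal δ C) C') : leaders C' = leaders C := by
  obtain ⟨hset, hI⟩ := hC'
  obtain ⟨hC'a, hC'I, hz⟩ := (isDiffCharSet_iff hr h1).1 hset
  have h₁ : leaders C' ⊆ thetaVars (leaders C) := by
    rintro u ⟨f, hf, hu⟩
    by_contra huC
    -- By coherence the initial would lie in the ideal, although it is nonzero and reduced with
    -- respect to `C'`.
    exact hu.initial_ne_zero (hz _ (hcoh.initial_mem δ hδ hr hC.1 (hC'I hf) hu huC)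
      (hu.initial_mem_supported_of (hC'a.mem_supported hr hf))
      fun a ha => hC'a.algAutoreduced.algReduced_initial hf ha)
  have h₂ : leaders C ⊆ thetaVars (leaders C') := by
    rintro u ⟨f, hf, hu⟩
    have hfI : f ∈ satDiffIdeal δ C :=
      thetaSet_subset_satDiffIdeal δ C (subset_thetaSet δ C hf)
    have hi : IsNZDMod (satDiffIdeal δ C) (initial f) :=
      isNZDMod_saturation _ (Submonoid.subset_closure (Or.inl ⟨f, hf, rfl⟩))
    rw [hI] at hset h1 hfI hi
    exact leader_mem_thetaVars hδ hr hset h1 hfI hu hi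
  exact Set.Subset.antisymm
    (subset_of_subset_thetaVars h₁ h₂ fun u hu θ hθ => hC'a.act_notMem_leaders hr hu hθ)
    (subset_of_subset_thetaVars h₂ h₁ fun u hu θ hθ => hC.act_notMem_leaders hr hu hθ)

theorem exists_isAlgCharacterizing {C : Set (MvPolynomial (DVar m n) k)}
    (hC : IsDiffCharSet (satDiffIdeal δ C) C) (h1 : 1 ∉ satDiffIdeal δ C) {L' : Set (DVar m n)}
    (hL : leaders C ⊆ L') :
    IsAlgCharacterizable (restrictIdeal (satDiffIdeal δ C)
      (prolongationVars (leaders C) L')) := by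
  have hwf := hr.wellFoundedLT
  obtain ⟨B, hB⟩ := exists_isTriangularSection δ C
  have h : ∀ f, ∃ g, IsAlgRem (B \ {f}) f g := fun f =>
    exists_isAlgRem (fun b hb c hc => hB.2.1.2 b hb.1 c hc.1) f
  choose algrem hrem using h
  obtain ⟨A, -, hA⟩ := hB.exists_isAlgCharacterizing hδ hr hC h1 hL fun f _ => hrem f
  exact ⟨A, hA⟩

theorem Coherent.isDiffCharacterizable_iff {C : Set (MvPolynomial (DVar m n) k)}
    (hC : Autoreduced C) (hcoh : Coherent δ C) (h1 : 1 ∉ satDiffIdeal δ C) {L' : Set (DVar m n)}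
    (hL : leaders C ⊆ L') (hL' : L' ⊆ thetaVars (leaders C)) :
    IsDiffCharacterizable δ (satDiffIdeal δ C) ↔
      IsAlgCharacterizable (restrictIdeal (satDiffIdeal δ C)
        (prolongationVars (leaders C) L')) := by
  have hwf := hr.wellFoundedLT
  constructor
  · rintro ⟨C', hC'⟩
    have hl := hcoh.leaders_eq hδ hr hC h1 hC'
    obtain ⟨hset, hI⟩ := hC'
    -- Present the ideal by `C'`: the leaders, and hence Z, are unchanged, and `C'` is a
    -- characteristic set.
    rw [hI] at hset h1 ⊢
    rw [← hl] at hL ⊢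
    exact exists_isAlgCharacterizing hδ hr hset h1 hL
  · rintro ⟨A, hA⟩
    refine ⟨_, (isDiffCharacterizing_of_restrictIdeal hδ hr hC h1 hL hL' hA ?_).2.2⟩
    obtain ⟨hAa, hAI, hz, -⟩ := (isAlgCharacterizing_restrictIdeal_iff h1).1 hA
    intro a ha u hu
    by_contra huC
    -- Since `C` need not be a characteristic set here, coherence locates the leaders of `A`: the
    -- initial would be a nonzero reduced element of the ideal.
    refine hu.initial_ne_zero (hz _ (hcoh.initial_mem δ hδ hr hC.1 (hAI ha) hu huC)
      (hu.initial_mem_supported_of ?_) fun b hb => hAa.algReduced_initial ha hb)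
    obtain ⟨a, -, rfl⟩ := ha
    exact rename_val_mem_supported a

/-- For a characteristic set, nonzerodivisor initials play the role that coherence plays in
`Coherent.isDiffCharacterizable_iff`. -/
theorem leaders_liftSet_subset {C : Set (MvPolynomial (DVar m n) k)}
    (hC : IsDiffCharSet (satDiffIdeal δ C) C) (h1 : 1 ∉ satDiffIdeal δ C) {Z : Set (DVar m n)}
    (hZ : reducedVars (leaders C) ⊆ Z) {A : Set (MvPolynomial Z k)}
    (hA : IsAlgCharacterizing (restrictIdeal (satDiffIdeal δ C) Z) A) :
    ∀ a ∈ liftSet A, ∀ u, IsLeader a u → u ∈ thetaVars (leaders C) := by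
  have hwf := hr.wellFoundedLT
  obtain ⟨-, hAI, -, hn⟩ := (isAlgCharacterizing_restrictIdeal_iff h1).1 hA
  intro a ha u hu
  refine leader_mem_thetaVars hδ hr hC h1 (hAI ha) hu
    (isNZDMod_of_supported hδ hr hC.1 fun p hp => ?_)
  exact hn _ (Or.inl ⟨a, ha, rfl⟩) p (supported_mono hZ hp)

-- A factor of an element with leader in `L` brings in no new variables, hence no proper derivative
-- of `L`. For such a factor, being free of the leaders of the subset and of all of `A` is the same.
omit hδ hr [CharZero k] in
theorem IsCanonicalForm.liftSet {L : Set (DVar m n)} {Z : Set (DVar m n)}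
    (hZ : reducedVars L ⊆ Z) {A : Set (MvPolynomial Z k)} (hA : IsCanonicalForm A)
    (hlead : ∀ a ∈ liftSet A, ∀ u, IsLeader a u → u ∈ thetaVars L)
    (hsup : ∀ a ∈ liftSet A, (∃ u ∈ L, IsLeader a u) → a ∈ supported k (reducedVars L)) :
    IsCanonicalForm {a ∈ liftSet A | ∃ u ∈ L, IsLeader a u} := by
  have hinj := rename_injective (R := k) (Subtype.val : Z → DVar m n) Subtype.val_injective
  rintro _ ⟨⟨f, hf, rfl⟩, u, hu, hfu⟩
  obtain ⟨h1, h2, h3⟩ := hA f hf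
  refine ⟨?_, ?_, h3.rename_val⟩
  · rintro v ⟨_, ⟨⟨a, ha, rfl⟩, -⟩, hav⟩ hv
    obtain ⟨v, rfl, hav'⟩ := hav.exists_of_rename_val
    rw [initial_rename_val, mem_vars_rename_val] at hv
    exact h1 v ⟨a, ha, hav'⟩ hv
  · rintro g ⟨h, hgh⟩ hg
    have hfs := hsup _ ⟨f, hf, rfl⟩ ⟨u, hu, hfu⟩
    have hgs := mem_supported_of_mul_eq hfs hfu.ne_zero hgh
    have hhs := mem_supported_of_mul_eq hfs hfu.ne_zero (hgh.trans (mul_comm _ _))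
    obtain ⟨g, rfl⟩ := exists_rename_val_eq (supported_mono hZ hgs)
    obtain ⟨h, rfl⟩ := exists_rename_val_eq (supported_mono hZ hhs)
    rw [← map_mul] at hgh
    have h0 := h2 g ⟨h, hinj hgh⟩ <| by
      rintro v ⟨a, ha, hav⟩ hv
      have hav' := isLeader_rename_val.2 hav
      have hv' := mem_vars_rename_val.2 hv
      have hvL : (v : DVar m n) ∈ L := by
        by_contra hvL
        exact MvPolynomial.mem_supported.1 hgs hv' ⟨hlead _ ⟨a, ha, rfl⟩ _ hav', hvL⟩
      exact hg v ⟨_, ⟨⟨a, ha, rfl⟩, v, hvL, hav'⟩, hav'⟩ hv'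
    rw [← Finset.not_nonempty_iff_eq_empty, vars_nonempty_rename_val,
      Finset.not_nonempty_iff_eq_empty, h0]

end Prolongation
end DiffAlg

theorem lemmal {k : Type*} [Field k] [CharZero k] {m n : ℕ}
    (δ : Fin m → Derivation ℤ k k) (hδ : ∀ i j a, δ i (δ j a) = δ j (δ i a))
    [LinearOrder (DiffAlg.DVar m n)] (hrank : DiffAlg.IsRanking m n) :
    (∀ C D : Set (MvPolynomial (DiffAlg.DVar m n) k),
      DiffAlg.Autoreduced C → DiffAlg.Coherent δ C → DiffAlg.IsProlongation δ C D →
      1 ∉ DiffAlg.satDiffIdeal δ C →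
        ((DiffAlg.satDiffIdeal δ C).IsPrime ↔
          (DiffAlg.restrictIdeal (DiffAlg.satDiffIdeal δ C)
            (DiffAlg.prolongationVars (DiffAlg.leaders C) (DiffAlg.leaders D))).IsPrime) ∧
        (DiffAlg.IsDiffCharacterizable δ (DiffAlg.satDiffIdeal δ C) ↔
          DiffAlg.IsAlgCharacterizable (DiffAlg.restrictIdeal (DiffAlg.satDiffIdeal δ C)
            (DiffAlg.prolongationVars (DiffAlg.leaders C) (DiffAlg.leaders D))))) ∧
    (∀ (C : Set (MvPolynomial (DiffAlg.DVar m n) k)) (L' : Set (DiffAlg.DVar m n)),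
      DiffAlg.IsDiffCharSet (DiffAlg.satDiffIdeal δ C) C →
      1 ∉ DiffAlg.satDiffIdeal δ C →
      DiffAlg.IsVarProlongation (DiffAlg.leaders C) L' →
        ((∃ B, DiffAlg.IsTriangularSection δ C B) ∧
          ∀ B, DiffAlg.IsTriangularSection δ C B →
            (∀ f ∈ B, ∃ g, DiffAlg.IsAlgRem (B \ {f}) f g) ∧
            ∀ algrem : MvPolynomial (DiffAlg.DVar m n) k → MvPolynomial (DiffAlg.DVar m n) k,
              (∀ f ∈ B, DiffAlg.IsAlgRem (B \ {f}) f (algrem f)) →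
              ∃ A : Set (MvPolynomial
                  (DiffAlg.prolongationVars (DiffAlg.leaders C) L') k),
                DiffAlg.liftSet A =
                  {g | ∃ f ∈ B, (∃ u ∈ L', DiffAlg.IsLeader f u) ∧ g = algrem f} ∧
                DiffAlg.IsAlgCharacterizing (DiffAlg.restrictIdeal (DiffAlg.satDiffIdeal δ C)
                  (DiffAlg.prolongationVars (DiffAlg.leaders C) L')) A) ∧
        (∀ A : Set (MvPolynomial (DiffAlg.prolongationVars (DiffAlg.leaders C) L') k),
          DiffAlg.IsAlgCharacterizing (DiffAlg.restrictIdeal (DiffAlg.satDiffIdeal δ C)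
            (DiffAlg.prolongationVars (DiffAlg.leaders C) L')) A →
          ∀ T, DiffAlg.IsMinWeakDTriangular (DiffAlg.liftSet A) T →
            (DiffAlg.Autoreduced T →
              DiffAlg.IsDiffCharacterizing δ (DiffAlg.satDiffIdeal δ C) T) ∧
            (DiffAlg.IsCanonicalForm A →
              DiffAlg.IsDiffCharacterizing δ (DiffAlg.satDiffIdeal δ C) T ∧
                DiffAlg.IsCanonicalForm T))) := by
  have hwf := hrank.wellFoundedLT
  refine ⟨fun C D hC hcoh hD h1 => ?_, fun C L' hC h1 hL => ⟨⟨?_, fun B hB => ⟨?_, ?_⟩⟩, ?_⟩⟩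
  · have hL : DiffAlg.leaders C ⊆ DiffAlg.leaders D := fun u ⟨f, hf, hu⟩ => ⟨f, hD.1 hf, hu⟩
    have hL' : DiffAlg.leaders D ⊆ DiffAlg.thetaVars (DiffAlg.leaders C) := by
      rw [← DiffAlg.leaders_thetaSet δ hδ hrank hC.1]
      exact fun u ⟨f, hf, hu⟩ => ⟨f, hD.2.1 hf, hu⟩
    refine ⟨⟨fun h => Ideal.comap_isPrime _ _, fun h => ?_⟩,
      hcoh.isDiffCharacterizable_iff hδ hrank hC h1 hL hL'⟩
    exact DiffAlg.restrictIdeal_isPrime_of hδ hrank hC h1 (DiffAlg.reducedVars_subset hL) h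
  · exact DiffAlg.exists_isTriangularSection δ C
  · exact fun f _ => DiffAlg.exists_isAlgRem (fun b hb c hc => hB.2.1.2 b hb.1 c hc.1) f
  · exact fun algrem hrem => hB.exists_isAlgCharacterizing hδ hrank hC h1 hL.1 hrem
  · intro A hA T hT
    have hZ := DiffAlg.reducedVars_subset (L := DiffAlg.leaders C) hL.1
    have hlead := DiffAlg.leaders_liftSet_subset hδ hrank hC h1 hZ hA
    obtain ⟨hCA, hsup, hchar⟩ :=
      DiffAlg.isDiffCharacterizing_of_restrictIdeal hδ hrank hC.1 h1 hL.1 hL.2.1 hA hlead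
    have htri := ((DiffAlg.isAlgCharacterizing_restrictIdeal_iff h1).1 hA).1.triangular
    rw [hT.eq hrank hC.1 htri hlead hCA]
    exact ⟨fun _ => hchar, fun hcan => ⟨hchar, hcan.liftSet hZ hlead hsup⟩⟩
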